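/- Let $G$ be a finite group and let $X$ be a finite set with a structure of $G$-family of biquandles, that is, operations $\underline{\triangleright}^g,\overline{\triangleright}^g:X\times X\to X$ $(g\in G)$ such that for all $g,h\in G$ and $a,b,c\in X$: (i) $a\,\underline{\triangleright}^g a=a\,\overline{\triangleright}^g a$; (ii) the maps $x\mapsto x\,\underline{\triangleright}^g a$, $x\mapsto x\,\overline{\triangleright}^g a$ and $(x,y)\mapsto(y\,\overline{\triangleright}^g x,\ x\,\underline{\triangleright}^h y)$ are bijections; (iii) $(a\,\underline{\triangleright}^g b)\underline{\triangleright}^h(c\,\overline{\triangleright}^g b)=(a\,\underline{\triangleright}^h c)\underline{\triangleright}^{h^{-1}gh}(b\,\underline{\triangleright}^h c)$, $(a\,\overline{\triangleright}^g b)\underline{\triangleright}^h(c\,\overline{\triangleright}^g b)=(a\,\underline{\triangleright}^h c)\overline{\triangleright}^{h^{-1}gh}(b\,\underline{\triangleright}^h c)$ and $(a\,\overline{\triangleright}^g b)\overline{\triangleright}^h(c\,\overline{\triangleright}^g b)=(a\,\overline{\triangleright}^h c)\overline{\triangleright}^{h^{-1}gh}(b\,\underline{\triangleright}^h c)$; (iv)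 $a\,\underline{\triangleright}^{gh}b=(a\,\underline{\triangleright}^g b)\underline{\triangleright}^h(b\,\underline{\triangleright}^g b)$ and $a\,\overline{\triangleright}^{gh}b=(a\,\overline{\triangleright}^g b)\overline{\triangleright}^h(b\,\overline{\triangleright}^g b)$. On $Q=X\times G$ put $(a,g)\,\underline{\triangleright}\,(b,h)=(a\,\underline{\triangleright}^h b,\,h^{-1}gh)$, $(a,g)\,\overline{\triangleright}\,(b,h)=(a\,\overline{\triangleright}^h b,\,g)$, and define the partial product $(a,g)\cdot(a\,\underline{\triangleright}^g a,h)=(a,gh)$. Let $\Gamma$ be a $Y$-oriented spatial trivalent graph diagram: a diagram of a directed spatial trivalent graph (circle components allowed) none of whose vertices is a source or a sink. An $X$-coloring of $\Gamma$ assigns an element of $Q$ to each semiarc (portion of the diagram between consecutive under-crossing points, over-crossing points and vertices) so that the following holds. At a crossing, let $p$ be the color of the under-semiarc to the right of the over-strand and $q$ the color of the over-semiarc to the right of the under-strand; then the other under-semiarc has color $p\,\underline{\triangleright}\,q$ and the other over-semiarc has color $q\,\overline{\triangleright}\,p$. At a vertex where two edges $e_r$ (right) and $e_l$ (left, seen in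 the direction of the flow) merge into $e$, or where $e$ splits into $e_r$ and $e_l$, the product of the colors of $e_r$ and $e_l$, in this order, is defined and equals the color of $e$. Let $\pi_1(S^3\setminus\Gamma)$ be given by the Wirtinger presentation of the diagram, with one generator (meridian) for each semiarc. For $\psi\in\mathrm{Hom}(\pi_1(S^3\setminus\Gamma),G)$ let $\pi^{-1}(\psi)$ be the set of $X$-colorings of $\Gamma$ whose $G$-component on each semiarc is the value of $\psi$ on its meridian, and set $$\Phi_X^G(\Gamma)=\sum_{\psi\in\mathrm{Hom}(\pi_1(S^3\setminus\Gamma),G)}u^{|\pi^{-1}(\psi)|}\in\mathbb{Z}[u].$$ If two $Y$-oriented spatial trivalent graph diagrams $\Gamma$ and $\Gamma'$ are related by a finite sequence of $Y$-oriented Reidemeister moves for handlebody-knots (the moves I-V for spatial trivalent graphs and the IH-move VI, with all $Y$-orientations), then $\Phi_X^G(\Gamma)=\Phi_X^G(\Gamma')$. Hence $\Phi_X^G$ is a well-defined invariant of $S^1$-oriented handlebody-knots and handlebody-links, understood as equivalence classes of $Y$-oriented diagrams under these moves. -/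

import Mathlib

open Polynomial

/-- A `G`-family of biquandles on `X`: `uop g a b` and `oop g a b` are `a` operated on by `b`
through the underlined, respectively the overlined, triangle of exponent `g`. -/
structure BiquandleFamily (G : Type*) [Group G] (X : Type*) where
  uop : G → X → X → X
  oop : G → X → X → X
  under_self : ∀ g a, uop g a a = oop g a a
  under_bijective : ∀ g a, Function.Bijective fun x => uop g x a
  over_bijective : ∀ g a, Function.Bijective fun x => oop g x a
  sideways_bijective : ∀ g h,
    Function.Bijective fun p : X × X => (oop g p.2 p.1, uop h p.1 p.2)
  exchange_under_under : ∀ g h a b c,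
    uop h (uop g a b) (oop g c b) = uop (h⁻¹ * g * h) (uop h a c) (uop h b c)
  exchange_over_under : ∀ g h a b c,
    uop h (oop g a b) (oop g c b) = oop (h⁻¹ * g * h) (uop h a c) (uop h b c)
  exchange_over_over : ∀ g h a b c,
    oop h (oop g a b) (oop g c b) = oop (h⁻¹ * g * h) (oop h a c) (uop h b c)
  under_mul : ∀ g h a b, uop (g * h) a b = uop h (uop g a b) (uop g b b)
  over_mul : ∀ g h a b, oop (g * h) a b = oop h (oop g a b) (oop g b b)

namespace BiquandleFamily

variable {G : Type*} [Group G] {X : Type*} (F : BiquandleFamily G X)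

/-! The partially multiplicative biquandle `Q = X × G` associated with a `G`-family. -/

/-- `(a, g) ▷ (b, h) = (a ▷^h b, h⁻¹ g h)` (underlined operation of `Q`). -/
def qUnder (p q : X × G) : X × G := (F.uop q.2 p.1 q.1, q.2⁻¹ * p.2 * q.2)

/-- `(a, g) ▷ (b, h) = (a ▷^h b, g)` (overlined operation of `Q`). -/
def qOver (p q : X × G) : X × G := (F.oop q.2 p.1 q.1, p.2)

/-- The graph of the partial multiplication of `Q`: the product `p q` is defined exactly for
`p = (a, g)`, `q = (a ▷^g a, h)`, and is then `(a, g h)`. -/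
def IsQMul (p q r : X × G) : Prop :=
  q.1 = F.uop p.2 p.1 p.1 ∧ r = (p.1, p.2 * q.2)

end BiquandleFamily

/-- The nodes of a `Y`-oriented spatial trivalent graph diagram, with their incident oriented
semiarcs.
* `crossing s ui uo oi oo`: a crossing, positive iff `s = true`; the under-strand enters along `ui`
  and leaves along `uo`, the over-strand enters along `oi` and leaves along `oo`.
* `merge r l o`: a vertex with two incoming edges `r`, `l` and one outgoing edge `o`; an observer
  looking in the direction of the flow has `r` on the right and `l` on the left.
* `split i r l`: a vertex with one incoming edge `i` and two outgoing edges, `r` on the right and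
  `l` on the left.
A vertex that is a source or a sink is not allowed. -/
inductive Node (E : Type*) where
  | crossing (s : Bool) (ui uo oi oo : E)
  | merge (r l o : E)
  | split (i r l : E)

namespace Node

variable {E E' : Type*}

/-- Relabelling of semiarcs. -/
def map (f : E → E') : Node E → Node E'
  | crossing s ui uo oi oo => crossing s (f ui) (f uo) (f oi) (f oo)
  | merge r l o => merge (f r) (f l) (f o)
  | split i r l => split (f i) (f r) (f l)

/-- The ends of semiarcs at a node, in counterclockwise cyclic order. The pair `(e, true)` is the
initial end of `e` (`e` leaves the node), `(e, false)` is its terminal end (`e` enters the node). -/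
def ends : Node E → List (E × Bool)
  | crossing true ui uo oi oo => [(oo, true), (uo, true), (oi, false), (ui, false)]
  | crossing false ui uo oi oo => [(oo, true), (ui, false), (oi, false), (uo, true)]
  | merge r l o => [(o, true), (l, false), (r, false)]
  | split i r l => [(i, false), (r, true), (l, true)]

/-- The colouring condition at a node, for colours in `Q = X × G`. At a crossing let `u`, `o` be the
under-semiarc to the right of the over-strand and the over-semiarc to the right of the
under-strand; the opposite semiarcs then carry the underlined `u ▷ o` and the overlined `o ▷ u`.
At a vertex the colour of the single edge is the product of the right one and the left one. -/
def IsColored {G : Type*} [Group G] {X : Type*} (F : BiquandleFamily G X) (c : E → X × G) :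
    Node E → Prop
  | crossing true ui uo oi oo =>
      c uo = F.qUnder (c ui) (c oo) ∧ c oi = F.qOver (c oo) (c ui)
  | crossing false ui uo oi oo =>
      c ui = F.qUnder (c uo) (c oi) ∧ c oo = F.qOver (c oi) (c uo)
  | merge r l o => F.IsQMul (c r) (c l) (c o)
  | split i r l => F.IsQMul (c r) (c l) (c i)

/-- The Wirtinger relators at a node. The generator of a semiarc is the loop from a base point above
the plane that passes below the semiarc from its right side to its left side. -/
def relators : Node E → List (FreeGroup E)
  | crossing true ui uo oi oo =>
      [.of oi * (.of oo)⁻¹, .of uo * ((.of oo)⁻¹ * .of ui * .of oo)⁻¹]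
  | crossing false ui uo oi oo =>
      [.of oo * (.of oi)⁻¹, .of ui * ((.of oi)⁻¹ * .of uo * .of oi)⁻¹]
  | merge r l o => [.of o * (.of r * .of l)⁻¹]
  | split i r l => [.of i * (.of r * .of l)⁻¹]

end Node

/-! ### Planarity

A list of nodes defines a combinatorial map: the edge ends with their counterclockwise order at each
node. It is drawn on a disjoint union of closed oriented surfaces, one for each connected component;
these are all spheres iff `V - E + F = 2 K`. -/

section Planarity

variable {E : Type*}

/-- The edge ends that occur in a list of nodes. -/
abbrev EndOf (N : List (Node E)) : Type _ := {d : E × Bool // ∃ n ∈ N, d ∈ n.ends}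

/-- `d'` follows `d` counterclockwise around a node. -/
def NextEnd (N : List (Node E)) (d d' : E × Bool) : Prop :=
  ∃ n ∈ N, (d, d') ∈ n.ends.zip (n.ends.rotate 1)

/-- One step along the boundary of a face: run along the edge from the end `d` to its other end, then
take the counterclockwise next end at the node reached. -/
def FaceStep (N : List (Node E)) (d d' : EndOf N) : Prop :=
  NextEnd N (d.1.1, !d.1.2) d'.1

/-- Two ends belong to the same edge or to the same node. -/
def Linked (N : List (Node E)) (d d' : EndOf N) : Prop :=
  d.1.1 = d'.1.1 ∨ ∃ n ∈ N, d.1 ∈ n.ends ∧ d'.1 ∈ n.ends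

/-- Twice the Euler formula: all components of the combinatorial map have genus `0`. The number of
edges is half the number of edge ends. -/
def IsPlanar (N : List (Node E)) : Prop :=
  2 * N.length + 2 * Nat.card (Quot (FaceStep N)) =
    Nat.card (EndOf N) + 4 * Nat.card (Quot (Linked N))

end Planarity

/-- A diagram of a `Y`-oriented spatial trivalent graph (with finitely many components, and up to
isotopy of the sphere): a finite set `E` of oriented semiarcs and a finite list of crossings and
vertices. Each semiarc either has one initial and one terminal end at the nodes, or is a closed
circle without any node on it. -/
structure Diagram where
  E : Type
  finite : Finite E
  nodes : List (Node E)
  nodup : (nodes.flatMap Node.ends).Nodup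
  initial_iff_terminal : ∀ e,
    (e, true) ∈ nodes.flatMap Node.ends ↔ (e, false) ∈ nodes.flatMap Node.ends
  planar : IsPlanar nodes

attribute [instance] Diagram.finite

/-! ### Fragments of diagrams and the Reidemeister moves -/

/-- A fragment of a diagram whose semiarcs may have been cut at finitely many points: a list of nodes,
and a list of strands `(a, b)` without nodes, entered along `a` and left along `b`. Fragments are
joined to each other wherever a piece leaving one of them has the same label as a piece entering
another. -/
structure Fragment where
  strands : List (ℕ × ℕ)
  nodes : List (Node ℕ)

namespace Fragment

/-- Relabelling of the pieces. -/
def map (f : ℕ → ℕ) (P : Fragment) : Fragment :=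
  ⟨P.strands.map (Prod.map f f), P.nodes.map (Node.map f)⟩

/-- Juxtaposition of fragments. -/
def append (P O : Fragment) : Fragment := ⟨P.strands ++ O.strands, P.nodes ++ O.nodes⟩

/-- All ends of pieces. -/
def ends (P : Fragment) : List (ℕ × Bool) :=
  P.strands.flatMap (fun s => [(s.1, false), (s.2, true)]) ++ P.nodes.flatMap Node.ends

/-- The labels of the pieces. -/
def labels (P : Fragment) : Set ℕ := {a | ∃ b, (a, b) ∈ P.ends}

/-- Every piece has exactly one initial and one terminal end: nothing is left open. -/
def IsClosed (P : Fragment) : Prop :=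
  P.ends.Nodup ∧ ∀ a, (a, true) ∈ P.ends ↔ (a, false) ∈ P.ends

/-- The closed fragment `P` is the diagram `D`, up to the names of the semiarcs, the order of the
nodes and the cutting of semiarcs into pieces: `s` sends each piece to the semiarc that contains it,
and two pieces lie on the same semiarc iff they are joined through strands. -/
def Represents (P : Fragment) (D : Diagram) : Prop :=
  P.IsClosed ∧ ∃ s : ℕ → D.E,
    (∀ e, ∃ a ∈ P.labels, s a = e) ∧
    (∀ a ∈ P.labels, ∀ b ∈ P.labels,
      s a = s b ↔ Relation.EqvGen (fun x y => (x, y) ∈ P.strands) a b) ∧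
    (P.nodes.map (Node.map s)).Perm D.nodes

end Fragment

namespace Move

/-- A pair of pieces, in the order in which a strand runs through them: `(x, y)` if `d`, else
`(y, x)`. -/
def directed (d : Bool) (x y : ℕ) : ℕ × ℕ := if d then (x, y) else (y, x)

/-- A crossing at which the strand `p.1 → p.2` crosses the strand `q.1 → q.2`, over it if `above`,
under it otherwise. The direction of `q` is to the left of the direction of `p` iff `left`. -/
def cross (above left : Bool) (p q : ℕ × ℕ) : Node ℕ :=
  if above then .crossing left q.1 q.2 p.1 p.2 else .crossing (!left) p.1 p.2 q.1 q.2

/-- A choice of directions of the three legs of a vertex (`true` for outgoing) for which the vertex is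
neither a source nor a sink. -/
def IsY (d₀ d₁ d₂ : Bool) : Prop := ¬ (d₀ = d₁ ∧ d₁ = d₂)

/-- The vertex with legs `x₀, x₁, x₂` in counterclockwise order, where `xᵢ` is outgoing iff `dᵢ`.
Only used for `IsY d₀ d₁ d₂`. -/
def vertex (d₀ d₁ d₂ : Bool) (x₀ x₁ x₂ : ℕ) : Node ℕ :=
  match d₀, d₁, d₂ with
  | true, false, false => .merge x₂ x₁ x₀
  | false, true, false => .merge x₀ x₂ x₁
  | false, false, _ => .merge x₁ x₀ x₂
  | false, true, true => .split x₀ x₁ x₂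
  | true, false, true => .split x₁ x₂ x₀
  | true, true, _ => .split x₂ x₀ x₁

/-- The first or the second step of a strand `x → y → z`. -/
def step (first : Bool) (x y z : ℕ) : ℕ × ℕ := if first then (x, y) else (y, z)

/-- The plain strand `0 → 1`. -/
def r1Left : Fragment := ⟨[(0, 1)], []⟩

/-- The strand `0 → 2 → 1` with one kink, of either sign, passing first under or first over. -/
def r1Right (sign underFirst : Bool) : Fragment :=
  if underFirst then ⟨[], [.crossing sign 0 2 2 1]⟩ else ⟨[], [.crossing sign 2 1 0 2]⟩

/-- Two plain strands `0 → 1` and `2 → 3`. -/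
def r2Left : Fragment := ⟨[(0, 1), (2, 3)], []⟩

/-- The strand `0 → 4 → 1` lies over the strand `2 → 5 → 3`, which it crosses twice; the two strands
run in the same direction iff `parallel`. -/
def r2Right (sign parallel : Bool) : Fragment :=
  if parallel then ⟨[], [.crossing sign 2 5 0 4, .crossing (!sign) 5 3 4 1]⟩
  else ⟨[], [.crossing sign 5 3 0 4, .crossing (!sign) 2 5 4 1]⟩

/-- Three strands, top `0 → 1 → 2`, middle `3 → 4 → 5`, bottom `6 → 7 → 8`, that form a triangle. The
signs of the crossings top/middle, top/bottom, middle/bottom are `x`, `y`, `z`. The two values of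
`side` are the two positions of a strand with respect to the crossing of the other two. -/
def r3 (x y z side : Bool) : Fragment :=
  -- on the top strand, the middle one comes before the bottom one
  let t := (x == y) == side
  -- on the middle strand, the top one comes before the bottom one
  let m := (x == z) == side
  -- on the bottom strand, the top one comes before the middle one
  let b := (y == z) == side
  ⟨[], [cross true x (step t 0 1 2) (step m 3 4 5),
        cross true y (step (!t) 0 1 2) (step b 6 7 8),
        cross true z (step (!m) 3 4 5) (step (!b) 6 7 8)]⟩

/-! In the next moves a vertex has three legs, to the south (outer piece `0`), the north-east (`1`) and
the north-west (`2`), with directions `dᵢ` (`true` if the leg is outgoing). -/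

/-- A strand with ends `3` (west) and `4` (east), running east iff `east`, passes over or under the
southern leg. -/
def r4Left (above east d₀ d₁ d₂ : Bool) : Fragment :=
  ⟨[], [vertex d₀ d₁ d₂ 5 1 2,
        cross above (east != d₀) (directed east 3 4) (directed d₀ 5 0)]⟩

/-- The same strand passes over or under the two northern legs. -/
def r4Right (above east d₀ d₁ d₂ : Bool) : Fragment :=
  ⟨[], [vertex d₀ d₁ d₂ 0 6 7,
        cross above (east == d₂) (directed east 3 8) (directed d₂ 7 2),
        cross above (east == d₁) (directed east 8 4) (directed d₁ 6 1)]⟩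

/-- A vertex. -/
def r5Left (d₀ d₁ d₂ : Bool) : Fragment := ⟨[], [vertex d₀ d₁ d₂ 0 1 2]⟩

/-- The two northern legs cross each other: the inner piece `3` leaves the vertex to the north-east and
continues to the north-western end `2`, the inner piece `4` leaves it to the north-west and continues
to the north-eastern end `1`. -/
def r5Right (above d₀ d₁ d₂ : Bool) : Fragment :=
  ⟨[], [vertex d₀ d₂ d₁ 0 3 4,
        cross above (d₁ != d₂) (directed d₂ 3 2) (directed d₁ 4 1)]⟩

/-! In the last move there are four legs, to the north-east (`0`), the north-west (`1`), the south-west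
(`2`) and the south-east (`3`), with directions `dᵢ` (`true` if outgoing), and an inner edge `4`. -/

/-- The inner edge is vertical, directed to the south iff `m`. -/
def r6Left (m d₀ d₁ d₂ d₃ : Bool) : Fragment :=
  ⟨[], [vertex d₀ d₁ m 0 1 4, vertex d₂ d₃ (!m) 2 3 4]⟩

/-- The inner edge is horizontal, directed to the east iff `m`. -/
def r6Right (m d₀ d₁ d₂ d₃ : Bool) : Fragment :=
  ⟨[], [vertex m d₁ d₂ 4 1 2, vertex d₀ (!m) d₃ 0 4 3]⟩

/-- The pairs of local pictures of the Reidemeister moves I - VI for handlebody-knots, with all their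
`Y`-orientations. Pieces with equal labels on the boundary of the two pictures correspond. -/
inductive Local : Fragment → Fragment → Prop
  | r1 (sign underFirst : Bool) : Local r1Left (r1Right sign underFirst)
  | r2 (sign parallel : Bool) : Local r2Left (r2Right sign parallel)
  | r3 (x y z : Bool) : Local (r3 x y z true) (r3 x y z false)
  | r4 (above east d₀ d₁ d₂ : Bool) (h : IsY d₀ d₁ d₂) :
      Local (r4Left above east d₀ d₁ d₂) (r4Right above east d₀ d₁ d₂)
  | r5 (above d₀ d₁ d₂ : Bool) (h : IsY d₀ d₁ d₂) :
      Local (r5Left d₀ d₁ d₂) (r5Right above d₀ d₁ d₂)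
  | r6 (m m' d₀ d₁ d₂ d₃ : Bool) (hn : IsY d₀ d₁ m) (hs : IsY d₂ d₃ (!m))
      (hw : IsY m' d₁ d₂) (he : IsY d₀ (!m') d₃) :
      Local (r6Left m d₀ d₁ d₂ d₃) (r6Right m' d₀ d₁ d₂ d₃)

end Move

namespace Diagram

/-- Two diagrams are the same up to the names of their semiarcs and the order of their nodes. -/
def Isotopic (D D' : Diagram) : Prop :=
  ∃ P : Fragment, P.Represents D ∧ P.Represents D'

/-- `D'` arises from `D` by one Reidemeister move: `D` and `D'` consist of the two pictures of a move
and of one and the same fragment `O` outside. -/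
def ReidemeisterMove (D D' : Diagram) : Prop :=
  ∃ (P P' O : Fragment) (f : ℕ → ℕ), Move.Local P P' ∧
    ((P.map f).append O).Represents D ∧ ((P'.map f).append O).Represents D'

/-- The equivalence of diagrams generated by the Reidemeister moves. -/
def relatedSetoid : Setoid Diagram :=
  Relation.EqvGen.setoid fun D D' => Isotopic D D' ∨ ReidemeisterMove D D'

/-- `D` and `D'` are related by a finite sequence of Reidemeister moves and their inverses. -/
def Related (D D' : Diagram) : Prop := relatedSetoid D D'

/-- The fundamental group of the complement of the spatial graph, by its Wirtinger presentation: one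
generator for each semiarc, and the relations at the crossings and vertices. -/
abbrev FundamentalGroup (D : Diagram) : Type :=
  PresentedGroup {w : FreeGroup D.E | ∃ n ∈ D.nodes, w ∈ n.relators}

/-- The meridian of a semiarc. -/
def meridian (D : Diagram) (e : D.E) : D.FundamentalGroup := PresentedGroup.of e

instance (D : Diagram) {G : Type*} [Group G] [Finite G] : Finite (D.FundamentalGroup →* G) :=
  Finite.of_injective (fun (ψ : D.FundamentalGroup →* G) (e : D.E) => ψ (D.meridian e)) fun _ _ h =>
    PresentedGroup.ext fun e => congrFun h e

/-- An `X`-colouring of the diagram: colours in `Q = X × G` on the semiarcs such that the condition at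
every crossing and every vertex holds. -/
def IsColoring {G : Type*} [Group G] {X : Type*} (F : BiquandleFamily G X) (D : Diagram)
    (c : D.E → X × G) : Prop := ∀ n ∈ D.nodes, n.IsColored F c

/-- The set of `X`-colourings that project to the `G`-colouring `ψ`. -/
def fiber {G : Type*} [Group G] {X : Type*} (F : BiquandleFamily G X) (D : Diagram)
    (ψ : D.FundamentalGroup →* G) : Set (D.E → X × G) :=
  {c | D.IsColoring F c ∧ ∀ e, (c e).2 = ψ (D.meridian e)}

open Classical in
/-- The `G`-enhanced biquandle counting polynomial: the sum of `u ^ |π⁻¹(ψ)|` over all homomorphisms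
`ψ` from the fundamental group of the complement to `G`. -/
noncomputable def enhancedPolynomial {G : Type*} [Group G] [Finite G] {X : Type*} [Finite X]
    (F : BiquandleFamily G X) (D : Diagram) : ℤ[X] :=
  letI := Fintype.ofFinite (D.FundamentalGroup →* G)
  ∑ ψ : D.FundamentalGroup →* G, (Polynomial.X : ℤ[X]) ^ (D.fiber F ψ).ncard

end Diagram

/-- An `S¹`-oriented handlebody-knot (or handlebody-link), as an equivalence class of `Y`-oriented
diagrams under the Reidemeister moves. -/
def HandlebodyKnot : Type 1 := Quotient Diagram.relatedSetoid

/-- The handlebody-knot represented by a diagram. -/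
def Diagram.handlebodyKnot (D : Diagram) : HandlebodyKnot := Quotient.mk _ D

/-! Related diagrams have corresponding colourings, and the correspondence respects the projection
to `G`. View each picture of a move as a disc with boundary pieces `B`. Two local facts suffice: the
colours on `B` determine the colouring of the disc (`IsDetermined`), and a colouring of one picture
can be replaced by a colouring of the other with the same colours on `B` (`Transfers`). Gluing in
the unchanged outside turns these into a bijection of colourings (`Realizes.existsUnique_coloring`,
`SameColorings`).

The fundamental group needs no separate treatment. Over the one-point family the colouring
conditions are the Wirtinger relations, so homomorphisms to `G` are colourings too. The labels and
the maps to semiarcs in `SameColorings` do not depend on the family, so the correspondence `ψ ↔ ψ'`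
for the one-point family and that of `X`-colourings are compatible. Hence the fibres over `ψ` and
`ψ'` are in bijection, and the polynomials agree term by term.

The local facts are algebra in `Q`. A crossing is a relation `Crossed A B C D` in which any two
adjacent pieces determine the other two, by (ii); this treats all orientations alike and already
gives move II. Move I uses (i) and the bijectivity of `a ↦ a ▷^g a`; here, and again in V,
finiteness of `X` enters. Move III is the closing of a cube by (iii). Move IV is the closing of a
prism by (iii) and (iv). Move V rests on `D · B = A · C` at a crossing and its variants in which one
leg is the product. Move VI is associativity of the partial product, a consequence of (iv). -/

namespace BiquandleFamily

variable {G : Type*} [Group G] {X : Type*} (F : BiquandleFamily G X)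

/-- The relation at a crossing: `A` is the under-semiarc to the right of the over-strand, `D` the
over-semiarc to the right of the under-strand, `B` and `C` are the opposite semiarcs. -/
def Crossed (A B C D : X × G) : Prop := B = F.qUnder A D ∧ C = F.qOver D A

/-! ### Bijectivity and exchange laws, lifted from `X` to `Q = X × G`. -/

variable {F}

lemma qUnder_bijective (q : X × G) : Function.Bijective fun p => F.qUnder p q := by
  obtain ⟨b, h⟩ := q
  constructor
  · rintro ⟨a, g⟩ ⟨a', g'⟩ e
    simp only [qUnder, Prod.mk.injEq] at e
    rw [Prod.mk.injEq]
    exact ⟨(F.under_bijective h b).1 e.1, by simpa using e.2⟩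
  · rintro ⟨a, g⟩
    obtain ⟨x, hx⟩ := (F.under_bijective h b).2 a
    exact ⟨(x, h * g * h⁻¹), by simp [qUnder, ← hx, mul_assoc]⟩

lemma qOver_bijective (q : X × G) : Function.Bijective fun p => F.qOver p q := by
  obtain ⟨b, h⟩ := q
  constructor
  · rintro ⟨a, g⟩ ⟨a', g'⟩ e
    simp only [qOver, Prod.mk.injEq] at e
    rw [Prod.mk.injEq]
    exact ⟨(F.over_bijective h b).1 e.1, e.2⟩
  · rintro ⟨a, g⟩
    obtain ⟨x, hx⟩ := (F.over_bijective h b).2 a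
    exact ⟨(x, g), by simp [qOver, ← hx]⟩

lemma q_sideways_injective {p q p' q' : X × G} (ho : F.qOver q p = F.qOver q' p')
    (hu : F.qUnder p q = F.qUnder p' q') : p = p' ∧ q = q' := by
  obtain ⟨a, g⟩ := p
  obtain ⟨b, h⟩ := q
  obtain ⟨a', g'⟩ := p'
  obtain ⟨b', h'⟩ := q'
  simp only [qOver, qUnder, Prod.mk.injEq] at ho hu
  obtain ⟨ho, rfl⟩ := ho
  obtain ⟨hu, hg⟩ := hu
  obtain rfl : g = g' := by simpa using hg
  have := (F.sideways_bijective g h).1 (a₁ := (a, b)) (a₂ := (a', b')) (by simp [ho, hu])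
  simp_all

lemma q_sideways_surjective (s t : X × G) : ∃ p q, F.qOver q p = s ∧ F.qUnder p q = t := by
  obtain ⟨b, h⟩ := s
  obtain ⟨a, g⟩ := t
  obtain ⟨⟨x, y⟩, hxy⟩ := (F.sideways_bijective (h * g * h⁻¹) h).2 (b, a)
  simp only [Prod.mk.injEq] at hxy
  exact ⟨(x, h * g * h⁻¹), (y, h), by simp [qOver, hxy.1], by simp [qUnder, hxy.2, mul_assoc]⟩

lemma q_exchange_under_under (a b c : X × G) :
    F.qUnder (F.qUnder a b) (F.qOver c b) = F.qUnder (F.qUnder a c) (F.qUnder b c) := by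
  simp [qUnder, qOver, F.exchange_under_under, mul_assoc]

lemma q_exchange_over_under (a b c : X × G) :
    F.qUnder (F.qOver a b) (F.qOver c b) = F.qOver (F.qUnder a c) (F.qUnder b c) := by
  simp [qUnder, qOver, F.exchange_over_under]

lemma q_exchange_over_over (a b c : X × G) :
    F.qOver (F.qOver a b) (F.qOver c b) = F.qOver (F.qOver a c) (F.qUnder b c) := by
  simp [qUnder, qOver, F.exchange_over_over]

/-! ### The squaring maps -/

/-- By (i) the sideways map preserves the diagonal, where it acts as squaring; its injectivity is
inherited. -/
lemma under_self_injective {g : G} {a b : X} (h : F.uop g a a = F.uop g b b) : a = b := by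
  have := (F.sideways_bijective g g).1 (a₁ := (a, a)) (a₂ := (b, b))
    (by simp [← F.under_self, h])
  simpa using this

lemma under_self_surjective [Finite X] (g : G) (b : X) : ∃ a, F.uop g a a = b :=
  Finite.surjective_of_injective (f := fun a => F.uop g a a)
    (fun _ _ h => under_self_injective h) b

lemma qUnder_self (p : X × G) : F.qUnder p p = F.qOver p p := by
  simp [qUnder, qOver, F.under_self]

/-- The hypothesis puts the sideways image of `(p, q)` on the diagonal. Squaring is onto, so this
image is also attained at a diagonal point, and injectivity makes the two points equal. This is what
undoes a kink. -/
lemma eq_of_qUnder_eq_qOver [Finite X] {p q : X × G} (h : F.qUnder p q = F.qOver q p) :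
    p = q := by
  obtain ⟨a, g⟩ := p
  obtain ⟨b, k⟩ := q
  simp only [qUnder, qOver, Prod.mk.injEq] at h
  obtain ⟨h, hg⟩ := h
  obtain rfl : g = k := by
    have := congrArg (fun x => k * x * k⁻¹) hg
    simpa [mul_assoc] using this
  obtain ⟨x, hx⟩ := under_self_surjective (F := F) g (F.uop g a b)
  have := (F.sideways_bijective g g).1 (a₁ := (x, x)) (a₂ := (a, b))
    (by simp [← F.under_self, hx, h])
  obtain ⟨rfl, rfl⟩ : x = a ∧ x = b := by simpa using this
  rfl

/-! ### The crossing relation -/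

namespace Crossed

variable {A B C D A' B' C' D' : X × G}

/-- The four corners of a crossing: `AD` is the definition, `AC` inverts the overlined operation,
`BD` the underlined one, and `BC` the sideways map. Which corner is known depends on the
orientations of the strands. -/
lemma mk_AD (A D : X × G) : ∃ B C, F.Crossed A B C D := ⟨_, _, rfl, rfl⟩

lemma mk_AC (A C : X × G) : ∃ B D, F.Crossed A B C D := by
  obtain ⟨D, hD⟩ := (qOver_bijective (F := F) A).2 C
  exact ⟨_, D, rfl, hD.symm⟩

lemma mk_BD (B D : X × G) : ∃ A C, F.Crossed A B C D := by
  obtain ⟨A, hA⟩ := (qUnder_bijective (F := F) D).2 B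
  exact ⟨A, _, hA.symm, rfl⟩

lemma mk_BC (B C : X × G) : ∃ A D, F.Crossed A B C D := by
  obtain ⟨A, D, h, h'⟩ := q_sideways_surjective (F := F) C B
  exact ⟨A, D, h'.symm, h.symm⟩

lemma uniq_AD (h : F.Crossed A B C D) (h' : F.Crossed A B' C' D) : B = B' ∧ C = C' :=
  ⟨h.1.trans h'.1.symm, h.2.trans h'.2.symm⟩

lemma uniq_AC (h : F.Crossed A B C D) (h' : F.Crossed A B' C D') : B = B' ∧ D = D' := by
  obtain rfl : D = D' := (qOver_bijective (F := F) A).1 (h.2.symm.trans h'.2)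
  exact ⟨(uniq_AD h h').1, rfl⟩

lemma uniq_BD (h : F.Crossed A B C D) (h' : F.Crossed A' B C' D) : A = A' ∧ C = C' := by
  obtain rfl : A = A' := (qUnder_bijective (F := F) D).1 (h.1.symm.trans h'.1)
  exact ⟨rfl, (uniq_AD h h').2⟩

lemma uniq_BC (h : F.Crossed A B C D) (h' : F.Crossed A' B C D') : A = A' ∧ D = D' :=
  q_sideways_injective (h.2.symm.trans h'.2) (h.1.symm.trans h'.1)

end Crossed

lemma Crossed.eq_of_eq_BC [Finite X] {A B D : X × G} (h : F.Crossed A B B D) : A = D :=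
  eq_of_qUnder_eq_qOver (h.1.symm.trans h.2)

lemma Crossed.eq_of_eq_AD {A B C : X × G} (h : F.Crossed A B C A) : B = C :=
  h.1.trans ((qUnder_self A).trans h.2.symm)

lemma Crossed.exists_self_left (A : X × G) : ∃ B, F.Crossed A B B A := ⟨_, rfl, qUnder_self A⟩

lemma Crossed.exists_self_right [Finite X] (B : X × G) : ∃ A, F.Crossed A B B A := by
  obtain ⟨a, ha⟩ := under_self_surjective (F := F) B.2 B.1
  exact ⟨(a, B.2), by simp [qUnder, ha], by simp [qOver, ← F.under_self, ha]⟩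

/-! ### The cube of the third Reidemeister move

The edges `a, b, c` belong to the bottom, the middle and the top strand. The index `i` of an edge
`aᵢ, bᵢ, cᵢ` in `{0, 1, 2, 3}` tells which of the two other strands, in alphabetical order, have been
crossed (none, the first, the second, both). -/

section Cube

variable {a₀ a₁ a₂ a₃ b₀ b₁ b₂ b₃ c₀ c₁ c₂ c₃ : X × G}

/-- The three faces at `a, b, c` can be computed freely. Each far edge `a₃, b₃, c₃` is then computed
along two faces, and the three exchange laws say that the results agree. -/
lemma exists_cube (a b c : X × G) : ∃ a₁ a₂ a₃ b₁ b₂ b₃ c₁ c₂ c₃,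
    (F.Crossed a a₁ b₁ b ∧ F.Crossed a a₂ c₁ c ∧ F.Crossed b b₂ c₂ c) ∧
    (F.Crossed a₂ a₃ b₃ b₂ ∧ F.Crossed a₁ a₃ c₃ c₂ ∧ F.Crossed b₁ b₃ c₃ c₁) :=
  ⟨_, _, _, _, _, _, _, _, _, ⟨⟨rfl, rfl⟩, ⟨rfl, rfl⟩, ⟨rfl, rfl⟩⟩, ⟨rfl, rfl⟩,
    ⟨(q_exchange_under_under a b c).symm, rfl⟩, (q_exchange_over_under b a c).symm,
    (q_exchange_over_over c a b).symm⟩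

/-- The faces form three opposite pairs, for the strands `ab`, `ac`, `bc` in this order. A digit `0`
means that the given face is the one at `a₀, b₀, c₀`, a digit `1` the opposite one. Three such faces
meet in a vertex of the cube, and move III trades them for the other three. In all eight cases the
missing ones among `a₀, b₀, c₀` are recovered from corners, the cube is built on them, and
uniqueness at corners identifies it with the given faces. -/
lemma cube_of_000 (h₁ : F.Crossed a₀ a₁ b₁ b₀) (h₂ : F.Crossed a₀ a₂ c₁ c₀)
    (h₃ : F.Crossed b₀ b₂ c₂ c₀) : ∃ a₃ b₃ c₃,
    F.Crossed a₂ a₃ b₃ b₂ ∧ F.Crossed a₁ a₃ c₃ c₂ ∧ F.Crossed b₁ b₃ c₃ c₁ := by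
  obtain ⟨a₁', a₂', a₃', b₁', b₂', b₃', c₁', c₂', c₃', ⟨k₁, k₂, k₃⟩, l₁, l₂, l₃⟩ :=
    exists_cube (F := F) a₀ b₀ c₀
  obtain ⟨rfl, rfl⟩ := h₁.uniq_AD k₁
  obtain ⟨rfl, rfl⟩ := h₂.uniq_AD k₂
  obtain ⟨rfl, rfl⟩ := h₃.uniq_AD k₃
  exact ⟨_, _, _, l₁, l₂, l₃⟩

lemma cube_of_001 (h₁ : F.Crossed a₀ a₁ b₁ b₀) (h₂ : F.Crossed a₀ a₂ c₁ c₀)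
    (h₃ : F.Crossed b₁ b₃ c₃ c₁) : ∃ a₃ b₂ c₂,
    F.Crossed a₂ a₃ b₃ b₂ ∧ F.Crossed a₁ a₃ c₃ c₂ ∧ F.Crossed b₀ b₂ c₂ c₀ := by
  obtain ⟨a₁', a₂', a₃', b₁', b₂', b₃', c₁', c₂', c₃', ⟨k₁, k₂, k₃⟩, l₁, l₂, l₃⟩ :=
    exists_cube (F := F) a₀ b₀ c₀
  obtain ⟨rfl, rfl⟩ := h₁.uniq_AD k₁
  obtain ⟨rfl, rfl⟩ := h₂.uniq_AD k₂
  obtain ⟨rfl, rfl⟩ := h₃.uniq_AD l₃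
  exact ⟨_, _, _, l₁, l₂, k₃⟩

lemma cube_of_010 (h₁ : F.Crossed a₀ a₁ b₁ b₀) (h₂ : F.Crossed a₁ a₃ c₃ c₂)
    (h₃ : F.Crossed b₀ b₂ c₂ c₀) : ∃ a₂ b₃ c₁,
    F.Crossed a₂ a₃ b₃ b₂ ∧ F.Crossed a₀ a₂ c₁ c₀ ∧ F.Crossed b₁ b₃ c₃ c₁ := by
  obtain ⟨a₁', a₂', a₃', b₁', b₂', b₃', c₁', c₂', c₃', ⟨k₁, k₂, k₃⟩, l₁, l₂, l₃⟩ :=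
    exists_cube (F := F) a₀ b₀ c₀
  obtain ⟨rfl, rfl⟩ := h₁.uniq_AD k₁
  obtain ⟨rfl, rfl⟩ := h₃.uniq_AD k₃
  obtain ⟨rfl, rfl⟩ := h₂.uniq_AD l₂
  exact ⟨_, _, _, l₁, k₂, l₃⟩

lemma cube_of_100 (h₁ : F.Crossed a₂ a₃ b₃ b₂) (h₂ : F.Crossed a₀ a₂ c₁ c₀)
    (h₃ : F.Crossed b₀ b₂ c₂ c₀) : ∃ a₁ b₁ c₃,
    F.Crossed a₀ a₁ b₁ b₀ ∧ F.Crossed a₁ a₃ c₃ c₂ ∧ F.Crossed b₁ b₃ c₃ c₁ := by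
  obtain ⟨a₁', a₂', a₃', b₁', b₂', b₃', c₁', c₂', c₃', ⟨k₁, k₂, k₃⟩, l₁, l₂, l₃⟩ :=
    exists_cube (F := F) a₀ b₀ c₀
  obtain ⟨rfl, rfl⟩ := h₂.uniq_AD k₂
  obtain ⟨rfl, rfl⟩ := h₃.uniq_AD k₃
  obtain ⟨rfl, rfl⟩ := h₁.uniq_AD l₁
  exact ⟨_, _, _, k₁, l₂, l₃⟩

lemma cube_of_011 (h₁ : F.Crossed a₀ a₁ b₁ b₀) (h₂ : F.Crossed a₁ a₃ c₃ c₂)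
    (h₃ : F.Crossed b₁ b₃ c₃ c₁) : ∃ a₂ b₂ c₀,
    F.Crossed a₂ a₃ b₃ b₂ ∧ F.Crossed a₀ a₂ c₁ c₀ ∧ F.Crossed b₀ b₂ c₂ c₀ := by
  obtain ⟨_, c₀, k⟩ := Crossed.mk_AC (F := F) b₀ c₂
  obtain ⟨a₁', a₂', a₃', b₁', b₂', b₃', c₁', c₂', c₃', ⟨k₁, k₂, k₃⟩, l₁, l₂, l₃⟩ :=
    exists_cube (F := F) a₀ b₀ c₀
  obtain ⟨rfl, rfl⟩ := h₁.uniq_AD k₁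
  obtain ⟨rfl, rfl⟩ := k.uniq_AD k₃
  obtain ⟨rfl, rfl⟩ := h₂.uniq_AD l₂
  obtain ⟨rfl, rfl⟩ := h₃.uniq_AC l₃
  exact ⟨_, _, _, l₁, k₂, k₃⟩

lemma cube_of_101 (h₁ : F.Crossed a₂ a₃ b₃ b₂) (h₂ : F.Crossed a₀ a₂ c₁ c₀)
    (h₃ : F.Crossed b₁ b₃ c₃ c₁) : ∃ a₁ b₀ c₂,
    F.Crossed a₀ a₁ b₁ b₀ ∧ F.Crossed a₁ a₃ c₃ c₂ ∧ F.Crossed b₀ b₂ c₂ c₀ := by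
  obtain ⟨_, b₀, k⟩ := Crossed.mk_AC (F := F) a₀ b₁
  obtain ⟨a₁', a₂', a₃', b₁', b₂', b₃', c₁', c₂', c₃', ⟨k₁, k₂, k₃⟩, l₁, l₂, l₃⟩ :=
    exists_cube (F := F) a₀ b₀ c₀
  obtain ⟨rfl, rfl⟩ := h₂.uniq_AD k₂
  obtain ⟨rfl, rfl⟩ := k.uniq_AD k₁
  obtain ⟨rfl, rfl⟩ := h₃.uniq_AD l₃
  obtain ⟨rfl, rfl⟩ := h₁.uniq_AC l₁
  exact ⟨_, _, _, k₁, l₂, k₃⟩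

lemma cube_of_110 (h₁ : F.Crossed a₂ a₃ b₃ b₂) (h₂ : F.Crossed a₁ a₃ c₃ c₂)
    (h₃ : F.Crossed b₀ b₂ c₂ c₀) : ∃ a₀ b₁ c₁,
    F.Crossed a₀ a₁ b₁ b₀ ∧ F.Crossed a₀ a₂ c₁ c₀ ∧ F.Crossed b₁ b₃ c₃ c₁ := by
  obtain ⟨a₀, _, k⟩ := Crossed.mk_BD (F := F) a₁ b₀
  obtain ⟨a₁', a₂', a₃', b₁', b₂', b₃', c₁', c₂', c₃', ⟨k₁, k₂, k₃⟩, l₁, l₂, l₃⟩ :=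
    exists_cube (F := F) a₀ b₀ c₀
  obtain ⟨rfl, rfl⟩ := h₃.uniq_AD k₃
  obtain ⟨rfl, rfl⟩ := k.uniq_AD k₁
  obtain ⟨rfl, rfl⟩ := h₂.uniq_AD l₂
  obtain ⟨rfl, rfl⟩ := h₁.uniq_BD l₁
  exact ⟨_, _, _, k₁, k₂, l₃⟩

lemma cube_of_111 (h₁ : F.Crossed a₂ a₃ b₃ b₂) (h₂ : F.Crossed a₁ a₃ c₃ c₂)
    (h₃ : F.Crossed b₁ b₃ c₃ c₁) : ∃ a₀ b₀ c₀,
    F.Crossed a₀ a₁ b₁ b₀ ∧ F.Crossed a₀ a₂ c₁ c₀ ∧ F.Crossed b₀ b₂ c₂ c₀ := by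
  obtain ⟨b₀, c₀, k⟩ := Crossed.mk_BC (F := F) b₂ c₂
  obtain ⟨a₀, _, k'⟩ := Crossed.mk_BD (F := F) a₁ b₀
  obtain ⟨a₁', a₂', a₃', b₁', b₂', b₃', c₁', c₂', c₃', ⟨k₁, k₂, k₃⟩, l₁, l₂, l₃⟩ :=
    exists_cube (F := F) a₀ b₀ c₀
  obtain ⟨rfl, rfl⟩ := k.uniq_AD k₃
  obtain ⟨rfl, rfl⟩ := k'.uniq_AD k₁
  obtain ⟨rfl, rfl⟩ := h₂.uniq_AD l₂
  obtain ⟨rfl, rfl⟩ := h₁.uniq_BD l₁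
  obtain ⟨rfl, rfl⟩ := h₃.uniq_BC l₃
  exact ⟨_, _, _, k₁, k₂, k₃⟩

end Cube

end BiquandleFamily

namespace BiquandleFamily

variable {G : Type*} [Group G] {X : Type*} {F : BiquandleFamily G X}

/-! ### The partial multiplication -/

namespace IsQMul

variable {p q r p' q' r' x y : X × G}

lemma mk_left_right (h : q.1 = F.uop p.2 p.1 p.1) : F.IsQMul p q (p.1, p.2 * q.2) := ⟨h, rfl⟩

lemma mk_left_product (h : r.1 = p.1) : ∃ q, F.IsQMul p q r :=
  ⟨(F.uop p.2 p.1 p.1, p.2⁻¹ * r.2), rfl, Prod.ext h (by simp)⟩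

lemma mk_right_product (h : q.1 = F.uop (r.2 * q.2⁻¹) r.1 r.1) : ∃ p, F.IsQMul p q r :=
  ⟨(r.1, r.2 * q.2⁻¹), h, Prod.ext rfl (by simp)⟩

lemma uniq_product (h : F.IsQMul p q r) (h' : F.IsQMul p q r') : r = r' := h.2.trans h'.2.symm

lemma fst_eq (h : F.IsQMul p q r) : r.1 = p.1 := by rw [h.2]

lemma snd_eq (h : F.IsQMul p q r) : r.2 = p.2 * q.2 := by rw [h.2]

lemma uniq_right (h : F.IsQMul p q r) (h' : F.IsQMul p q' r) : q = q' :=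
  Prod.ext (h.1.trans h'.1.symm) (mul_left_cancel (h.snd_eq.symm.trans h'.snd_eq))

lemma uniq_left (h : F.IsQMul p q r) (h' : F.IsQMul p' q r) : p = p' :=
  Prod.ext (h.fst_eq.symm.trans h'.fst_eq) (mul_right_cancel (h.snd_eq.symm.trans h'.snd_eq))

/-- The product `p q` can be followed by exactly the same factors as `q` can. This consequence of
(iv) makes the partial product associative. -/
lemma under_self_fst (h : F.IsQMul p q r) : F.uop r.2 r.1 r.1 = F.uop q.2 q.1 q.1 := by
  rw [h.snd_eq, h.fst_eq, F.under_mul, h.1]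

end IsQMul

/-! ### Associativity

The sides and the diagonals of a quadrilateral, or the edges of a tetrahedron, carry three factors and
their partial products. -/

section Assoc

variable {p₁ p₂ p₃ p₁₂ p₂₃ p₁₂₃ : X × G}

/-- The four partial products are the faces of a tetrahedron. Two faces share an inner edge, and the
other two share the opposite edge: `p₁₂` is opposite to `p₂₃`, `p₁` to `p₃`, and `p₂` to `p₁₂₃`. The
six lemmas treat the six possible inner edges. -/
lemma assoc_left (h : F.IsQMul p₁ p₂ p₁₂) (h' : F.IsQMul p₁₂ p₃ p₁₂₃) :
    ∃ p₂₃, F.IsQMul p₂ p₃ p₂₃ ∧ F.IsQMul p₁ p₂₃ p₁₂₃ :=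
  ⟨_, IsQMul.mk_left_right (by rw [h'.1, h.under_self_fst]),
    h.1, Prod.ext (h'.fst_eq.trans h.fst_eq) (by rw [h'.snd_eq, h.snd_eq, mul_assoc])⟩

lemma assoc_right (h : F.IsQMul p₂ p₃ p₂₃) (h' : F.IsQMul p₁ p₂₃ p₁₂₃) :
    ∃ p₁₂, F.IsQMul p₁ p₂ p₁₂ ∧ F.IsQMul p₁₂ p₃ p₁₂₃ := by
  have k : F.IsQMul p₁ p₂ (p₁.1, p₁.2 * p₂.2) :=
    IsQMul.mk_left_right (by rw [← h.fst_eq, h'.1])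
  exact ⟨_, k, by rw [k.under_self_fst, h.1],
    Prod.ext h'.fst_eq (by rw [h'.snd_eq, h.snd_eq, mul_assoc])⟩

lemma assoc_of_inner_first (h : F.IsQMul p₁ p₂ p₁₂) (h' : F.IsQMul p₁ p₂₃ p₁₂₃) :
    ∃ p₃, F.IsQMul p₁₂ p₃ p₁₂₃ ∧ F.IsQMul p₂ p₃ p₂₃ := by
  obtain ⟨p₃, k⟩ := IsQMul.mk_left_product (F := F) (p := p₂) (r := p₂₃) (by rw [h.1, h'.1])
  obtain ⟨x, l, m⟩ := assoc_right k h'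
  obtain rfl := h.uniq_product l
  exact ⟨p₃, m, k⟩

lemma assoc_of_inner_last [Finite X] (h : F.IsQMul p₁₂ p₃ p₁₂₃) (h' : F.IsQMul p₂ p₃ p₂₃) :
    ∃ p₁, F.IsQMul p₁ p₂ p₁₂ ∧ F.IsQMul p₁ p₂₃ p₁₂₃ := by
  obtain ⟨p₁, k⟩ := IsQMul.mk_right_product (F := F) (q := p₂) (r := p₁₂) (by
    -- Composability of `p₁` with `p₂` is tested after squaring with exponent `p₂.2`: by (iv) both
    -- sides become squares that equal `p₃.1`.
    refine under_self_injective (F := F) (g := p₂.2) ?_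
    rw [← F.under_mul, inv_mul_cancel_right, ← h.1, ← h'.1])
  obtain ⟨x, l, m⟩ := assoc_left k h
  obtain rfl := h'.uniq_product l
  exact ⟨p₁, k, m⟩

lemma assoc_of_inner_middle (h : F.IsQMul p₁ p₂ p₁₂) (h' : F.IsQMul p₂ p₃ p₂₃) :
    ∃ p₁₂₃, F.IsQMul p₁₂ p₃ p₁₂₃ ∧ F.IsQMul p₁ p₂₃ p₁₂₃ := by
  have k : F.IsQMul p₁ p₂₃ (p₁.1, p₁.2 * p₂₃.2) :=
    IsQMul.mk_left_right (by rw [h'.fst_eq, h.1])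
  obtain ⟨x, l, m⟩ := assoc_right h' k
  obtain rfl := h.uniq_product l
  exact ⟨_, m, k⟩

lemma assoc_of_inner_total (h : F.IsQMul p₁₂ p₃ p₁₂₃) (h' : F.IsQMul p₁ p₂₃ p₁₂₃) :
    ∃ p₂, F.IsQMul p₁ p₂ p₁₂ ∧ F.IsQMul p₂ p₃ p₂₃ := by
  obtain ⟨p₂, k⟩ := IsQMul.mk_left_product (F := F) (p := p₁) (r := p₁₂)
    (h.fst_eq.symm.trans h'.fst_eq)
  obtain ⟨x, l, m⟩ := assoc_left k h
  obtain rfl := h'.uniq_right m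
  exact ⟨p₂, k, l⟩

end Assoc

/-! ### Crossing legs of a vertex -/

section Twist

variable {A B C D x : X × G}

/-- Either product is defined exactly when `A` and `D` have the same `X`-component. The products
then agree because `k (k⁻¹ g k) = g k`. -/
lemma mul_iff_of_crossed (h : F.Crossed A B C D) :
    F.IsQMul D B x ↔ F.IsQMul A C x := by
  obtain ⟨rfl, rfl⟩ := h
  obtain ⟨a, g⟩ := A
  obtain ⟨b, k⟩ := D
  simp only [IsQMul, qUnder, qOver]
  have e : ∀ h, F.uop h a b = F.uop h b b ↔ a = b := fun h => (F.under_bijective h b).1.eq_iff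
  have e' : F.oop g b a = F.uop g a a ↔ a = b := by
    rw [F.under_self, (F.over_bijective g a).1.eq_iff, eq_comm]
  rw [e, e']
  refine and_congr_right ?_
  rintro rfl
  simp [mul_assoc]

/-- Here one crossing leg is the product at the vertex and the other is a factor of it. -/
lemma mul_of_crossed_product_left (h : F.Crossed A B C D) (hm : F.IsQMul D x A) :
    F.IsQMul x C B := by
  obtain ⟨rfl, rfl⟩ := h
  obtain ⟨c, k⟩ := x
  obtain ⟨rfl, rfl⟩ := hm
  simp [IsQMul, qUnder, qOver, ← F.under_self, F.under_mul]

lemma mul_of_crossed_product_right (h : F.Crossed A B C D) (hm : F.IsQMul A x D) :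
    F.IsQMul x B C := by
  obtain ⟨rfl, rfl⟩ := h
  obtain ⟨c, k⟩ := x
  obtain ⟨rfl, rfl⟩ := hm
  simp [IsQMul, qUnder, qOver, ← F.under_self, F.under_mul, mul_assoc]

/-- For the converse, a candidate for `D` is made from `x` by extracting a square root. The forward
direction gives its outgoing pieces; they agree with `B` and `C`, and the corner `BC` identifies the
candidate. -/
lemma mul_iff_of_crossed_product_left [Finite X] (h : F.Crossed A B C D) :
    F.IsQMul D x A ↔ F.IsQMul x C B := by
  refine ⟨mul_of_crossed_product_left h, fun hm => ?_⟩
  obtain ⟨b, hb⟩ := under_self_surjective (F := F) D.2 x.1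
  have k : F.IsQMul (b, D.2) x _ := IsQMul.mk_left_right hb.symm
  obtain ⟨B', C', l⟩ := Crossed.mk_AD (F := F) (b, D.2 * x.2) (b, D.2)
  have m := mul_of_crossed_product_left l k
  obtain rfl : C = C' := Prod.ext (hm.1.trans m.1.symm) (by rw [h.2, l.2]; rfl)
  obtain rfl := hm.uniq_product m
  obtain ⟨hA, hD⟩ := h.uniq_BC l
  rw [hD, hA]
  exact k

lemma mul_iff_of_crossed_product_right [Finite X] (h : F.Crossed A B C D) :
    F.IsQMul A x D ↔ F.IsQMul x B C := by
  refine ⟨mul_of_crossed_product_right h, fun hm => ?_⟩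
  obtain ⟨a, ha⟩ := under_self_surjective (F := F) A.2 x.1
  have k : F.IsQMul (a, A.2) x _ := IsQMul.mk_left_right ha.symm
  obtain ⟨B', C', l⟩ := Crossed.mk_AD (F := F) (a, A.2) (a, A.2 * x.2)
  have m := mul_of_crossed_product_right l k
  obtain rfl : C = C' := by
    refine Prod.ext (hm.fst_eq.trans m.fst_eq.symm) ?_
    have e := hm.snd_eq
    rw [h.1, h.2] at e
    simp only [qUnder, qOver] at e
    -- In `G` the product reads `x D⁻¹ A D = D`; cancelling `D` gives `D = A x`.
    have e' : D.2 = A.2 * x.2 := by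
      rw [← mul_assoc, ← mul_assoc] at e
      have := mul_right_cancel (b := D.2) (a := 1) (c := x.2 * D.2⁻¹ * A.2) (by simpa using e)
      rw [mul_assoc, eq_comm, mul_eq_one_iff_inv_eq] at this
      rw [← inv_inv x.2, this]; simp
    rw [h.2, l.2]
    exact e'
  obtain rfl := hm.uniq_right m
  obtain ⟨hA, hD⟩ := h.uniq_BC l
  rw [hA, hD]
  exact k

end Twist

/-! ### A strand passing a vertex

The legs `p, q, r = p q` of a vertex become `p', q', r'` when they cross a strand, the pieces of which
are `s₀, s₁, s₂`. -/

section Prism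

variable {p q r p' q' r' s₀ s₁ s₂ : X × G}

/-- The exchange law makes `p'` and `q'` composable. Multiplicativity (iv) makes the strand end in
the same colour `s₂` whether it passes over `p` and `q` in turn or over `r`. -/
lemma exists_prism_over (h : F.IsQMul p q r) (s₀ : X × G) : ∃ p' q' r' s₁ s₂,
    F.IsQMul p' q' r' ∧ F.Crossed p p' s₁ s₀ ∧ F.Crossed q q' s₂ s₁ ∧ F.Crossed r r' s₂ s₀ := by
  obtain ⟨a, g⟩ := p
  obtain ⟨b, k⟩ := q
  obtain ⟨c, m⟩ := s₀
  obtain ⟨rfl, rfl⟩ : b = F.uop g a a ∧ r = (a, g * k) := h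
  refine ⟨_, _, _, _, _, ?_, ⟨rfl, rfl⟩, ⟨rfl, rfl⟩, rfl, ?_⟩
  · simp [IsQMul, qUnder, qOver, F.exchange_under_under, mul_assoc]
  · simp [qOver, F.over_mul, F.under_self]

lemma exists_prism_under (h : F.IsQMul p q r) (s₀ : X × G) : ∃ p' q' r' s₁ s₂,
    F.IsQMul p' q' r' ∧ F.Crossed s₀ s₁ p' p ∧ F.Crossed s₁ s₂ q' q ∧ F.Crossed s₀ s₂ r' r := by
  obtain ⟨a, g⟩ := p
  obtain ⟨b, k⟩ := q
  obtain ⟨c, m⟩ := s₀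
  obtain ⟨rfl, rfl⟩ : b = F.uop g a a ∧ r = (a, g * k) := h
  refine ⟨_, _, _, _, _, ?_, ⟨rfl, rfl⟩, ⟨rfl, rfl⟩, ?_, rfl⟩
  · simp [IsQMul, qUnder, qOver, F.exchange_over_under, mul_assoc]
  · simp [qUnder, F.under_mul, mul_assoc]

lemma exists_prism_over_symm (h : F.IsQMul p' q' r') (s₀ : X × G) : ∃ p q r s₁ s₂,
    F.IsQMul p q r ∧ F.Crossed p p' s₁ s₀ ∧ F.Crossed q q' s₂ s₁ ∧ F.Crossed r r' s₂ s₀ := by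
  obtain ⟨p, s₁, hp⟩ := Crossed.mk_BD (F := F) p' s₀
  -- The second factor must have the square of `p` as its `X`-component; its `G`-component is chosen
  -- so that conjugation by `s₁` gives that of `q'`.
  have k : F.IsQMul p (F.uop p.2 p.1 p.1, s₁.2 * q'.2 * s₁.2⁻¹) _ := IsQMul.mk_left_right rfl
  obtain ⟨_, q'', r'', _, s₂, hm, hp', hq, hr⟩ := exists_prism_over k s₀
  obtain ⟨rfl, rfl⟩ := hp.uniq_AD hp'
  obtain rfl : q' = q'' := by
    refine Prod.ext (h.1.trans hm.1.symm) ?_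
    rw [hq.1]
    simp [qUnder, mul_assoc]
  obtain rfl := h.uniq_product hm
  exact ⟨_, _, _, _, _, k, hp, hq, hr⟩

/-- This and its variants complete the prism from one triangle and one or two of the crossings. The
names tell whether the triangle is primed and which legs have known crossings. The missing corner
data yield `s₀`, and uniqueness identifies the rest. -/
lemma prism_over_p (h : F.IsQMul p q r) (hp : F.Crossed p p' s₁ s₀) :
    ∃ q' r' s₂, F.IsQMul p' q' r' ∧ F.Crossed q q' s₂ s₁ ∧ F.Crossed r r' s₂ s₀ := by
  obtain ⟨_, _, _, _, _, hm, kp, kq, kr⟩ := exists_prism_over h s₀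
  obtain ⟨rfl, rfl⟩ := hp.uniq_AD kp
  exact ⟨_, _, _, hm, kq, kr⟩

lemma prism_over_q (h : F.IsQMul p q r) (hq : F.Crossed q q' s₂ s₁) :
    ∃ p' r' s₀, F.IsQMul p' q' r' ∧ F.Crossed p p' s₁ s₀ ∧ F.Crossed r r' s₂ s₀ := by
  obtain ⟨_, s₀, k⟩ := Crossed.mk_AC (F := F) p s₁
  obtain ⟨_, _, _, _, _, hm, kp, kq, kr⟩ := exists_prism_over h s₀
  obtain ⟨rfl, rfl⟩ := k.uniq_AD kp
  obtain ⟨rfl, rfl⟩ := hq.uniq_AD kq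
  exact ⟨_, _, _, hm, kp, kr⟩

lemma prism_over_r (h : F.IsQMul p q r) (hr : F.Crossed r r' s₂ s₀) :
    ∃ p' q' s₁, F.IsQMul p' q' r' ∧ F.Crossed p p' s₁ s₀ ∧ F.Crossed q q' s₂ s₁ := by
  obtain ⟨_, _, _, _, _, hm, kp, kq, kr⟩ := exists_prism_over h s₀
  obtain ⟨rfl, rfl⟩ := hr.uniq_AD kr
  exact ⟨_, _, _, hm, kp, kq⟩

lemma prism_over_qr (h : F.IsQMul p q r) (hq : F.Crossed q q' s₂ s₁) (hr : F.Crossed r r' s₂ s₀) :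
    ∃ p', F.IsQMul p' q' r' ∧ F.Crossed p p' s₁ s₀ := by
  obtain ⟨_, _, _, _, _, hm, kp, kq, kr⟩ := exists_prism_over h s₀
  obtain ⟨rfl, rfl⟩ := hr.uniq_AD kr
  obtain ⟨rfl, rfl⟩ := hq.uniq_AC kq
  exact ⟨_, hm, kp⟩

lemma prism_over_pr (h : F.IsQMul p q r) (hp : F.Crossed p p' s₁ s₀) (hr : F.Crossed r r' s₂ s₀) :
    ∃ q', F.IsQMul p' q' r' ∧ F.Crossed q q' s₂ s₁ := by
  obtain ⟨_, _, _, _, _, hm, kp, kq, kr⟩ := exists_prism_over h s₀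
  obtain ⟨rfl, rfl⟩ := hp.uniq_AD kp
  obtain ⟨rfl, rfl⟩ := hr.uniq_AD kr
  exact ⟨_, hm, kq⟩

lemma prism_over_pq (h : F.IsQMul p q r) (hp : F.Crossed p p' s₁ s₀) (hq : F.Crossed q q' s₂ s₁) :
    ∃ r', F.IsQMul p' q' r' ∧ F.Crossed r r' s₂ s₀ := by
  obtain ⟨_, _, _, _, _, hm, kp, kq, kr⟩ := exists_prism_over h s₀
  obtain ⟨rfl, rfl⟩ := hp.uniq_AD kp
  obtain ⟨rfl, rfl⟩ := hq.uniq_AD kq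
  exact ⟨_, hm, kr⟩

lemma prism_over_primed_p (h : F.IsQMul p' q' r') (hp : F.Crossed p p' s₁ s₀) :
    ∃ q r s₂, F.IsQMul p q r ∧ F.Crossed q q' s₂ s₁ ∧ F.Crossed r r' s₂ s₀ := by
  obtain ⟨_, _, _, _, _, hm, kp, kq, kr⟩ := exists_prism_over_symm h s₀
  obtain ⟨rfl, rfl⟩ := hp.uniq_BD kp
  exact ⟨_, _, _, hm, kq, kr⟩

lemma prism_over_primed_q (h : F.IsQMul p' q' r') (hq : F.Crossed q q' s₂ s₁) :
    ∃ p r s₀, F.IsQMul p q r ∧ F.Crossed p p' s₁ s₀ ∧ F.Crossed r r' s₂ s₀ := by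
  obtain ⟨_, s₀, k⟩ := Crossed.mk_BC (F := F) p' s₁
  obtain ⟨_, _, _, _, _, hm, kp, kq, kr⟩ := exists_prism_over_symm h s₀
  obtain ⟨rfl, rfl⟩ := k.uniq_BD kp
  obtain ⟨rfl, rfl⟩ := hq.uniq_BD kq
  exact ⟨_, _, _, hm, kp, kr⟩

lemma prism_over_primed_r (h : F.IsQMul p' q' r') (hr : F.Crossed r r' s₂ s₀) :
    ∃ p q s₁, F.IsQMul p q r ∧ F.Crossed p p' s₁ s₀ ∧ F.Crossed q q' s₂ s₁ := by
  obtain ⟨_, _, _, _, _, hm, kp, kq, kr⟩ := exists_prism_over_symm h s₀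
  obtain ⟨rfl, rfl⟩ := hr.uniq_BD kr
  exact ⟨_, _, _, hm, kp, kq⟩

lemma prism_over_primed_qr (h : F.IsQMul p' q' r') (hq : F.Crossed q q' s₂ s₁)
    (hr : F.Crossed r r' s₂ s₀) :
    ∃ p, F.IsQMul p q r ∧ F.Crossed p p' s₁ s₀ := by
  obtain ⟨_, _, _, _, _, hm, kp, kq, kr⟩ := exists_prism_over_symm h s₀
  obtain ⟨rfl, rfl⟩ := hr.uniq_BD kr
  obtain ⟨rfl, rfl⟩ := hq.uniq_BC kq
  exact ⟨_, hm, kp⟩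

lemma prism_over_primed_pr (h : F.IsQMul p' q' r') (hp : F.Crossed p p' s₁ s₀)
    (hr : F.Crossed r r' s₂ s₀) :
    ∃ q, F.IsQMul p q r ∧ F.Crossed q q' s₂ s₁ := by
  obtain ⟨_, _, _, _, _, hm, kp, kq, kr⟩ := exists_prism_over_symm h s₀
  obtain ⟨rfl, rfl⟩ := hp.uniq_BD kp
  obtain ⟨rfl, rfl⟩ := hr.uniq_BD kr
  exact ⟨_, hm, kq⟩

lemma prism_over_primed_pq (h : F.IsQMul p' q' r') (hp : F.Crossed p p' s₁ s₀)
    (hq : F.Crossed q q' s₂ s₁) :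
    ∃ r, F.IsQMul p q r ∧ F.Crossed r r' s₂ s₀ := by
  obtain ⟨_, _, _, _, _, hm, kp, kq, kr⟩ := exists_prism_over_symm h s₀
  obtain ⟨rfl, rfl⟩ := hp.uniq_BD kp
  obtain ⟨rfl, rfl⟩ := hq.uniq_BD kq
  exact ⟨_, hm, kr⟩

lemma exists_prism_under_symm (h : F.IsQMul p' q' r') (s₀ : X × G) : ∃ p q r s₁ s₂,
    F.IsQMul p q r ∧ F.Crossed s₀ s₁ p' p ∧ F.Crossed s₁ s₂ q' q ∧ F.Crossed s₀ s₂ r' r := by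
  obtain ⟨s₁, p, hp⟩ := Crossed.mk_AC (F := F) s₀ p'
  -- The legs now lie over the strand, so they keep their `G`-components.
  have k : F.IsQMul p (F.uop p.2 p.1 p.1, q'.2) _ := IsQMul.mk_left_right rfl
  obtain ⟨_, q'', r'', _, s₂, hm, hp', hq, hr⟩ := exists_prism_under k s₀
  obtain ⟨rfl, rfl⟩ := hp.uniq_AD hp'
  obtain rfl : q' = q'' := by
    refine Prod.ext (h.1.trans hm.1.symm) ?_
    rw [hq.2]
    rfl
  obtain rfl := h.uniq_product hm
  exact ⟨_, _, _, _, _, k, hp, hq, hr⟩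

lemma prism_under_p (h : F.IsQMul p q r) (hp : F.Crossed s₀ s₁ p' p) :
    ∃ q' r' s₂, F.IsQMul p' q' r' ∧ F.Crossed s₁ s₂ q' q ∧ F.Crossed s₀ s₂ r' r := by
  obtain ⟨_, _, _, _, _, hm, kp, kq, kr⟩ := exists_prism_under h s₀
  obtain ⟨rfl, rfl⟩ := hp.uniq_AD kp
  exact ⟨_, _, _, hm, kq, kr⟩

lemma prism_under_q (h : F.IsQMul p q r) (hq : F.Crossed s₁ s₂ q' q) :
    ∃ p' r' s₀, F.IsQMul p' q' r' ∧ F.Crossed s₀ s₁ p' p ∧ F.Crossed s₀ s₂ r' r := by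
  obtain ⟨s₀, _, k⟩ := Crossed.mk_BD (F := F) s₁ p
  obtain ⟨_, _, _, _, _, hm, kp, kq, kr⟩ := exists_prism_under h s₀
  obtain ⟨rfl, rfl⟩ := k.uniq_AD kp
  obtain ⟨rfl, rfl⟩ := hq.uniq_AD kq
  exact ⟨_, _, _, hm, kp, kr⟩

lemma prism_under_r (h : F.IsQMul p q r) (hr : F.Crossed s₀ s₂ r' r) :
    ∃ p' q' s₁, F.IsQMul p' q' r' ∧ F.Crossed s₀ s₁ p' p ∧ F.Crossed s₁ s₂ q' q := by
  obtain ⟨_, _, _, _, _, hm, kp, kq, kr⟩ := exists_prism_under h s₀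
  obtain ⟨rfl, rfl⟩ := hr.uniq_AD kr
  exact ⟨_, _, _, hm, kp, kq⟩

lemma prism_under_qr (h : F.IsQMul p q r) (hq : F.Crossed s₁ s₂ q' q) (hr : F.Crossed s₀ s₂ r' r) :
    ∃ p', F.IsQMul p' q' r' ∧ F.Crossed s₀ s₁ p' p := by
  obtain ⟨_, _, _, _, _, hm, kp, kq, kr⟩ := exists_prism_under h s₀
  obtain ⟨rfl, rfl⟩ := hr.uniq_AD kr
  obtain ⟨rfl, rfl⟩ := hq.uniq_BD kq
  exact ⟨_, hm, kp⟩

lemma prism_under_pr (h : F.IsQMul p q r) (hp : F.Crossed s₀ s₁ p' p) (hr : F.Crossed s₀ s₂ r' r) :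
    ∃ q', F.IsQMul p' q' r' ∧ F.Crossed s₁ s₂ q' q := by
  obtain ⟨_, _, _, _, _, hm, kp, kq, kr⟩ := exists_prism_under h s₀
  obtain ⟨rfl, rfl⟩ := hp.uniq_AD kp
  obtain ⟨rfl, rfl⟩ := hr.uniq_AD kr
  exact ⟨_, hm, kq⟩

lemma prism_under_pq (h : F.IsQMul p q r) (hp : F.Crossed s₀ s₁ p' p) (hq : F.Crossed s₁ s₂ q' q) :
    ∃ r', F.IsQMul p' q' r' ∧ F.Crossed s₀ s₂ r' r := by
  obtain ⟨_, _, _, _, _, hm, kp, kq, kr⟩ := exists_prism_under h s₀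
  obtain ⟨rfl, rfl⟩ := hp.uniq_AD kp
  obtain ⟨rfl, rfl⟩ := hq.uniq_AD kq
  exact ⟨_, hm, kr⟩

lemma prism_under_primed_p (h : F.IsQMul p' q' r') (hp : F.Crossed s₀ s₁ p' p) :
    ∃ q r s₂, F.IsQMul p q r ∧ F.Crossed s₁ s₂ q' q ∧ F.Crossed s₀ s₂ r' r := by
  obtain ⟨_, _, _, _, _, hm, kp, kq, kr⟩ := exists_prism_under_symm h s₀
  obtain ⟨rfl, rfl⟩ := hp.uniq_AC kp
  exact ⟨_, _, _, hm, kq, kr⟩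

lemma prism_under_primed_q (h : F.IsQMul p' q' r') (hq : F.Crossed s₁ s₂ q' q) :
    ∃ p r s₀, F.IsQMul p q r ∧ F.Crossed s₀ s₁ p' p ∧ F.Crossed s₀ s₂ r' r := by
  obtain ⟨s₀, _, k⟩ := Crossed.mk_BC (F := F) s₁ p'
  obtain ⟨_, _, _, _, _, hm, kp, kq, kr⟩ := exists_prism_under_symm h s₀
  obtain ⟨rfl, rfl⟩ := k.uniq_AC kp
  obtain ⟨rfl, rfl⟩ := hq.uniq_AC kq
  exact ⟨_, _, _, hm, kp, kr⟩

lemma prism_under_primed_r (h : F.IsQMul p' q' r') (hr : F.Crossed s₀ s₂ r' r) :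
    ∃ p q s₁, F.IsQMul p q r ∧ F.Crossed s₀ s₁ p' p ∧ F.Crossed s₁ s₂ q' q := by
  obtain ⟨_, _, _, _, _, hm, kp, kq, kr⟩ := exists_prism_under_symm h s₀
  obtain ⟨rfl, rfl⟩ := hr.uniq_AC kr
  exact ⟨_, _, _, hm, kp, kq⟩

lemma prism_under_primed_qr (h : F.IsQMul p' q' r') (hq : F.Crossed s₁ s₂ q' q)
    (hr : F.Crossed s₀ s₂ r' r) :
    ∃ p, F.IsQMul p q r ∧ F.Crossed s₀ s₁ p' p := by
  obtain ⟨_, _, _, _, _, hm, kp, kq, kr⟩ := exists_prism_under_symm h s₀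
  obtain ⟨rfl, rfl⟩ := hr.uniq_AC kr
  obtain ⟨rfl, rfl⟩ := hq.uniq_BC kq
  exact ⟨_, hm, kp⟩

lemma prism_under_primed_pr (h : F.IsQMul p' q' r') (hp : F.Crossed s₀ s₁ p' p)
    (hr : F.Crossed s₀ s₂ r' r) :
    ∃ q, F.IsQMul p q r ∧ F.Crossed s₁ s₂ q' q := by
  obtain ⟨_, _, _, _, _, hm, kp, kq, kr⟩ := exists_prism_under_symm h s₀
  obtain ⟨rfl, rfl⟩ := hp.uniq_AC kp
  obtain ⟨rfl, rfl⟩ := hr.uniq_AC kr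
  exact ⟨_, hm, kq⟩

lemma prism_under_primed_pq (h : F.IsQMul p' q' r') (hp : F.Crossed s₀ s₁ p' p)
    (hq : F.Crossed s₁ s₂ q' q) :
    ∃ r, F.IsQMul p q r ∧ F.Crossed s₀ s₂ r' r := by
  obtain ⟨_, _, _, _, _, hm, kp, kq, kr⟩ := exists_prism_under_symm h s₀
  obtain ⟨rfl, rfl⟩ := hp.uniq_AC kp
  obtain ⟨rfl, rfl⟩ := hq.uniq_AC kq
  exact ⟨_, hm, kr⟩

end Prism
end BiquandleFamily

/-! ### Colourings of fragments relative to their boundary. -/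

namespace Fragment

/-- The colouring condition for a fragment: strands do not change colours. -/
def IsColored {G : Type*} [Group G] {X : Type*} (F : BiquandleFamily G X) (P : Fragment)
    (k : ℕ → X × G) : Prop :=
  (∀ s ∈ P.strands, k s.1 = k s.2) ∧ ∀ n ∈ P.nodes, n.IsColored F k

/-- The pieces in `B` occur in `P`, all other pieces have both their ends in `P`. -/
def HasBoundary (B : List ℕ) (P : Fragment) : Prop :=
  (∀ a ∈ B, (a, true) ∈ P.ends ∨ (a, false) ∈ P.ends) ∧
    ∀ d ∈ P.ends, d.1 ∈ B ∨ (d.1, true) ∈ P.ends ∧ (d.1, false) ∈ P.ends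

instance (B : List ℕ) (P : Fragment) : Decidable (P.HasBoundary B) := by
  unfold HasBoundary; infer_instance

variable {G : Type*} [Group G] {X : Type*} (F : BiquandleFamily G X)

/-- A colouring of `P` is determined by its values on the pieces in `B`. -/
def IsDetermined (B : List ℕ) (P : Fragment) : Prop :=
  ∀ k k' : ℕ → X × G, P.IsColored F k → P.IsColored F k' → (∀ a ∈ B, k a = k' a) →
    ∀ d ∈ P.ends, k d.1 = k' d.1

/-- Every colouring of `P` can be changed to a colouring of `P'` with the same values on `B`. -/
def Transfers (B : List ℕ) (P P' : Fragment) : Prop :=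
  ∀ k : ℕ → X × G, P.IsColored F k → ∃ k', P'.IsColored F k' ∧ ∀ a ∈ B, k' a = k a

end Fragment

/-! ### The pictures of the moves: boundary pieces, and determination of colourings by them. -/

namespace Move

variable {G : Type*} [Group G] {X : Type*} {F : BiquandleFamily G X}

@[simp] lemma isColored_crossing_true {E : Type*} {c : E → X × G} {ui uo oi oo : E} :
    (Node.crossing true ui uo oi oo).IsColored F c ↔ F.Crossed (c ui) (c uo) (c oi) (c oo) := Iff.rfl

@[simp] lemma isColored_crossing_false {E : Type*} {c : E → X × G} {ui uo oi oo : E} :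
    (Node.crossing false ui uo oi oo).IsColored F c ↔ F.Crossed (c uo) (c ui) (c oo) (c oi) := Iff.rfl

@[simp] lemma isColored_merge {E : Type*} {c : E → X × G} {r l o : E} :
    (Node.merge r l o).IsColored F c ↔ F.IsQMul (c r) (c l) (c o) := Iff.rfl

@[simp] lemma isColored_split {E : Type*} {c : E → X × G} {r l i : E} :
    (Node.split i r l).IsColored F c ↔ F.IsQMul (c r) (c l) (c i) := Iff.rfl

lemma r1_boundary (s u : Bool) :
    r1Left.HasBoundary [0, 1] ∧ (r1Right s u).HasBoundary [0, 1] := by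
  revert s u; decide

lemma r2_boundary (s u : Bool) :
    r2Left.HasBoundary [0, 1, 2, 3] ∧ (r2Right s u).HasBoundary [0, 1, 2, 3] := by
  revert s u; decide

lemma r3_boundary (x y z s : Bool) : (r3 x y z s).HasBoundary [0, 2, 3, 5, 6, 8] := by
  revert x y z s; decide

lemma r4_boundary (a e d₀ d₁ d₂ : Bool) (h : IsY d₀ d₁ d₂) :
    (r4Left a e d₀ d₁ d₂).HasBoundary [0, 1, 2, 3, 4] ∧
      (r4Right a e d₀ d₁ d₂).HasBoundary [0, 1, 2, 3, 4] := by
  revert a e d₀ d₁ d₂; unfold IsY; decide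

lemma r5_boundary (a d₀ d₁ d₂ : Bool) (h : IsY d₀ d₁ d₂) :
    (r5Left d₀ d₁ d₂).HasBoundary [0, 1, 2] ∧ (r5Right a d₀ d₁ d₂).HasBoundary [0, 1, 2] := by
  revert a d₀ d₁ d₂; unfold IsY; decide

lemma r6Left_boundary (m d₀ d₁ d₂ d₃ : Bool) (hn : IsY d₀ d₁ m) (hs : IsY d₂ d₃ (!m)) :
    (r6Left m d₀ d₁ d₂ d₃).HasBoundary [0, 1, 2, 3] := by
  revert m d₀ d₁ d₂ d₃; unfold IsY; decide

lemma r6Right_boundary (m d₀ d₁ d₂ d₃ : Bool) (hw : IsY m d₁ d₂) (he : IsY d₀ (!m) d₃) :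
    (r6Right m d₀ d₁ d₂ d₃).HasBoundary [0, 1, 2, 3] := by
  revert m d₀ d₁ d₂ d₃; unfold IsY; decide

section Colored

open BiquandleFamily

lemma isDetermined_r1Left : r1Left.IsDetermined F [0, 1] := by
  intro k k' hk hk' e
  simpa [r1Left, Fragment.ends] using e

/-- The two outer pieces at the crossing are adjacent and so determine the inner piece. The same
holds in the other pictures with crossings, except `r4Left`, where the vertex determines the inner
leg. -/
lemma isDetermined_r1Right (s u : Bool) : (r1Right s u).IsDetermined F [0, 1] := by
  intro k k' hk hk' e
  cases s <;> cases u <;>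
    simp [Fragment.IsColored, Fragment.ends, Node.ends, r1Right] at hk hk' e ⊢ <;>
    grind [Crossed.uniq_AD, Crossed.uniq_BC]

lemma isDetermined_r2Left : r2Left.IsDetermined F [0, 1, 2, 3] := by
  intro k k' hk hk' e
  simp [r2Left, Fragment.ends] at e ⊢
  tauto

lemma isDetermined_r2Right (s u : Bool) : (r2Right s u).IsDetermined F [0, 1, 2, 3] := by
  intro k k' hk hk' e
  cases s <;> cases u <;>
    simp [Fragment.IsColored, Fragment.ends, Node.ends, r2Right] at hk hk' e ⊢ <;>
    grind [Crossed.uniq_AD, Crossed.uniq_BC, Crossed.uniq_AC, Crossed.uniq_BD]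

lemma isDetermined_r3 (x y z s : Bool) : (r3 x y z s).IsDetermined F [0, 2, 3, 5, 6, 8] := by
  intro k k' hk hk' e
  cases x <;> cases y <;> cases z <;> cases s <;>
    simp [Fragment.IsColored, Fragment.ends, Node.ends, r3, cross, step] at hk hk' e ⊢ <;>
    grind [Crossed.uniq_AD, Crossed.uniq_BC, Crossed.uniq_AC, Crossed.uniq_BD]

lemma isDetermined_r4Left (a e d₀ d₁ d₂ : Bool) (h : IsY d₀ d₁ d₂) :
    (r4Left a e d₀ d₁ d₂).IsDetermined F [0, 1, 2, 3, 4] := by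
  intro k k' hk hk' eq
  cases a <;> cases e <;> cases d₀ <;> cases d₁ <;> cases d₂ <;> simp [IsY] at h <;>
    simp [Fragment.IsColored, Fragment.ends, Node.ends, r4Left, cross, vertex, directed]
      at hk hk' eq ⊢ <;>
    grind [IsQMul.uniq_product, IsQMul.uniq_left, IsQMul.uniq_right]

lemma isDetermined_r4Right (a e d₀ d₁ d₂ : Bool) (h : IsY d₀ d₁ d₂) :
    (r4Right a e d₀ d₁ d₂).IsDetermined F [0, 1, 2, 3, 4] := by
  intro k k' hk hk' eq
  cases a <;> cases e <;> cases d₀ <;> cases d₁ <;> cases d₂ <;> simp [IsY] at h <;>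
    simp [Fragment.IsColored, Fragment.ends, Node.ends, r4Right, cross, vertex, directed]
      at hk hk' eq ⊢ <;>
    grind [Crossed.uniq_AD, Crossed.uniq_BC, Crossed.uniq_AC, Crossed.uniq_BD]

lemma isDetermined_r5Left (d₀ d₁ d₂ : Bool) : (r5Left d₀ d₁ d₂).IsDetermined F [0, 1, 2] := by
  intro k k' _ _ eq
  cases d₀ <;> cases d₁ <;> cases d₂ <;>
    simp [Fragment.ends, Node.ends, r5Left, vertex] at eq ⊢ <;> tauto

lemma isDetermined_r5Right (a d₀ d₁ d₂ : Bool) (h : IsY d₀ d₁ d₂) :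
    (r5Right a d₀ d₁ d₂).IsDetermined F [0, 1, 2] := by
  intro k k' hk hk' eq
  cases a <;> cases d₀ <;> cases d₁ <;> cases d₂ <;> simp [IsY] at h <;>
    simp [Fragment.IsColored, Fragment.ends, Node.ends, r5Right, cross, vertex, directed]
      at hk hk' eq ⊢ <;>
    grind [Crossed.uniq_AD, Crossed.uniq_BC, Crossed.uniq_AC, Crossed.uniq_BD]

lemma isDetermined_r6Left (m d₀ d₁ d₂ d₃ : Bool) (hn : IsY d₀ d₁ m) (hs : IsY d₂ d₃ (!m)) :
    (r6Left m d₀ d₁ d₂ d₃).IsDetermined F [0, 1, 2, 3] := by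
  intro k k' hk hk' eq
  cases m <;> cases d₀ <;> cases d₁ <;> cases d₂ <;> cases d₃ <;> simp [IsY] at hn hs <;>
    simp [Fragment.IsColored, Fragment.ends, Node.ends, r6Left, vertex] at hk hk' eq ⊢ <;>
    grind [IsQMul.uniq_product, IsQMul.uniq_left, IsQMul.uniq_right]

lemma isDetermined_r6Right (m d₀ d₁ d₂ d₃ : Bool) (hw : IsY m d₁ d₂) (he : IsY d₀ (!m) d₃) :
    (r6Right m d₀ d₁ d₂ d₃).IsDetermined F [0, 1, 2, 3] := by
  intro k k' hk hk' eq
  cases m <;> cases d₀ <;> cases d₁ <;> cases d₂ <;> cases d₃ <;> simp [IsY] at hw he <;>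
    simp [Fragment.IsColored, Fragment.ends, Node.ends, r6Right, vertex] at hk hk' eq ⊢ <;>
    grind [IsQMul.uniq_product, IsQMul.uniq_left, IsQMul.uniq_right]

end Colored
end Move

/-! ### Transfer of colourings between the two pictures of each move. -/

namespace Move

variable {G : Type*} [Group G] {X : Type*} {F : BiquandleFamily G X}

open BiquandleFamily

lemma transfers_of_update₁ {B : List ℕ} {P P' : Fragment} (a : ℕ) (ha : a ∉ B)
    (h : ∀ k : ℕ → X × G, P.IsColored F k → ∃ x, P'.IsColored F (Function.update k a x)) :
    P.Transfers F B P' := fun k hk => by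
  obtain ⟨x, hx⟩ := h k hk
  exact ⟨_, hx, fun i hi => Function.update_of_ne (ne_of_mem_of_not_mem hi ha) _ _⟩

lemma transfers_of_update₃ {B : List ℕ} {P P' : Fragment} (a b c : ℕ) (ha : a ∉ B) (hb : b ∉ B)
    (hc : c ∉ B) (h : ∀ k : ℕ → X × G, P.IsColored F k → ∃ x y z,
      P'.IsColored F (Function.update (Function.update (Function.update k a x) b y) c z)) :
    P.Transfers F B P' := fun k hk => by
  obtain ⟨x, y, z, hx⟩ := h k hk
  refine ⟨_, hx, fun i hi => ?_⟩
  rw [Function.update_of_ne (ne_of_mem_of_not_mem hi hc), Function.update_of_ne (ne_of_mem_of_not_mem hi hb),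
    Function.update_of_ne (ne_of_mem_of_not_mem hi ha)]

lemma r1_transfers [Finite X] (s u : Bool) : r1Left.Transfers F [0, 1] (r1Right s u) := by
  refine transfers_of_update₁ 2 (by decide) fun k hk => ?_
  have e : k 0 = k 1 := by simpa [Fragment.IsColored, r1Left] using hk
  cases s <;> cases u <;>
    simp [Fragment.IsColored, r1Right, Function.update_apply, -Prod.exists, e] <;>
    first
    | exact Crossed.exists_self_left _
    | exact Crossed.exists_self_right _

lemma r1_transfers_symm [Finite X] (s u : Bool) : (r1Right s u).Transfers F [0, 1] r1Left := by
  refine fun k hk => ⟨k, ?_, fun _ _ => rfl⟩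
  suffices k 0 = k 1 by simpa [Fragment.IsColored, r1Left] using this
  cases s <;> cases u <;> simp [Fragment.IsColored, r1Right] at hk <;>
    grind [Crossed.eq_of_eq_AD, Crossed.eq_of_eq_BC]

lemma r2_transfers (s u : Bool) : r2Left.Transfers F [0, 1, 2, 3] (r2Right s u) := by
  suffices h : ∀ k : ℕ → X × G, r2Left.IsColored F k → ∃ x y,
      (r2Right s u).IsColored F (Function.update (Function.update k 4 x) 5 y) by
    refine fun k hk => ?_
    obtain ⟨x, y, hx⟩ := h k hk
    exact ⟨_, hx, by simp [Function.update_apply]⟩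
  intro k hk
  obtain ⟨e, e'⟩ : k 0 = k 1 ∧ k 2 = k 3 := by simpa [Fragment.IsColored, r2Left] using hk
  cases s <;> cases u <;> simp [Fragment.IsColored, r2Right, Function.update_apply, -Prod.exists,
      -exists_and_left, -exists_and_right, e, e']
  · obtain ⟨_, _, h⟩ := Crossed.mk_AD (F := F) (k 3) (k 1)
    exact ⟨_, _, h⟩
  · obtain ⟨_, _, h⟩ := Crossed.mk_BD (F := F) (k 3) (k 1)
    exact ⟨_, _, h⟩
  · obtain ⟨_, _, h⟩ := Crossed.mk_BC (F := F) (k 3) (k 1)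
    exact ⟨_, _, h⟩
  · obtain ⟨_, _, h⟩ := Crossed.mk_AC (F := F) (k 3) (k 1)
    exact ⟨_, _, h⟩

lemma r2_transfers_symm (s u : Bool) : (r2Right s u).Transfers F [0, 1, 2, 3] r2Left := by
  refine fun k hk => ⟨k, ?_, fun _ _ => rfl⟩
  suffices k 0 = k 1 ∧ k 2 = k 3 by simpa [Fragment.IsColored, r2Left] using this
  cases s <;> cases u <;> simp [Fragment.IsColored, r2Right] at hk <;>
    grind [Crossed.uniq_AD, Crossed.uniq_BC, Crossed.uniq_AC, Crossed.uniq_BD]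

lemma r3_transfers (x y z : Bool) :
    (r3 x y z true).Transfers F [0, 2, 3, 5, 6, 8] (r3 x y z false) := by
  refine transfers_of_update₃ 1 4 7 (by decide) (by decide) (by decide) fun k hk => ?_
  cases x <;> cases y <;> cases z <;>
    simp [Fragment.IsColored, r3, cross, step, Function.update_apply, -Prod.exists,
      -exists_and_left, -exists_and_right] at hk ⊢ <;>
    -- The crossings are listed as top/middle, top/bottom, middle/bottom, which are the faces `bc`,
    -- `ac`, `ab`; hence the reversed order.
    obtain ⟨h₃, h₂, h₁⟩ := hk <;>
    first
    | obtain ⟨_, _, _, l₁, l₂, l₃⟩ := cube_of_000 h₁ h₂ h₃; exact ⟨_, _, _, l₃, l₂, l₁⟩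
    | obtain ⟨_, _, _, l₁, l₂, l₃⟩ := cube_of_001 h₁ h₂ h₃; exact ⟨_, _, _, l₃, l₂, l₁⟩
    | obtain ⟨_, _, _, l₁, l₂, l₃⟩ := cube_of_010 h₁ h₂ h₃; exact ⟨_, _, _, l₃, l₂, l₁⟩
    | obtain ⟨_, _, _, l₁, l₂, l₃⟩ := cube_of_100 h₁ h₂ h₃; exact ⟨_, _, _, l₃, l₂, l₁⟩
    | obtain ⟨_, _, _, l₁, l₂, l₃⟩ := cube_of_011 h₁ h₂ h₃; exact ⟨_, _, _, l₃, l₂, l₁⟩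
    | obtain ⟨_, _, _, l₁, l₂, l₃⟩ := cube_of_101 h₁ h₂ h₃; exact ⟨_, _, _, l₃, l₂, l₁⟩
    | obtain ⟨_, _, _, l₁, l₂, l₃⟩ := cube_of_110 h₁ h₂ h₃; exact ⟨_, _, _, l₃, l₂, l₁⟩
    | obtain ⟨_, _, _, l₁, l₂, l₃⟩ := cube_of_111 h₁ h₂ h₃; exact ⟨_, _, _, l₃, l₂, l₁⟩

lemma r3_transfers_symm (x y z : Bool) :
    (r3 x y z false).Transfers F [0, 2, 3, 5, 6, 8] (r3 x y z true) := by
  refine transfers_of_update₃ 1 4 7 (by decide) (by decide) (by decide) fun k hk => ?_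
  cases x <;> cases y <;> cases z <;>
    simp [Fragment.IsColored, r3, cross, step, Function.update_apply, -Prod.exists,
      -exists_and_left, -exists_and_right] at hk ⊢ <;>
    obtain ⟨h₃, h₂, h₁⟩ := hk <;>
    first
    | obtain ⟨_, _, _, l₁, l₂, l₃⟩ := cube_of_000 h₁ h₂ h₃; exact ⟨_, _, _, l₃, l₂, l₁⟩
    | obtain ⟨_, _, _, l₁, l₂, l₃⟩ := cube_of_001 h₁ h₂ h₃; exact ⟨_, _, _, l₃, l₂, l₁⟩
    | obtain ⟨_, _, _, l₁, l₂, l₃⟩ := cube_of_010 h₁ h₂ h₃; exact ⟨_, _, _, l₃, l₂, l₁⟩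
    | obtain ⟨_, _, _, l₁, l₂, l₃⟩ := cube_of_100 h₁ h₂ h₃; exact ⟨_, _, _, l₃, l₂, l₁⟩
    | obtain ⟨_, _, _, l₁, l₂, l₃⟩ := cube_of_011 h₁ h₂ h₃; exact ⟨_, _, _, l₃, l₂, l₁⟩
    | obtain ⟨_, _, _, l₁, l₂, l₃⟩ := cube_of_101 h₁ h₂ h₃; exact ⟨_, _, _, l₃, l₂, l₁⟩
    | obtain ⟨_, _, _, l₁, l₂, l₃⟩ := cube_of_110 h₁ h₂ h₃; exact ⟨_, _, _, l₃, l₂, l₁⟩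
    | obtain ⟨_, _, _, l₁, l₂, l₃⟩ := cube_of_111 h₁ h₂ h₃; exact ⟨_, _, _, l₃, l₂, l₁⟩

/-- The southern leg plays the part of `p`, `q` or `r`, lies on either side of the strand and passes
over or under it: twelve situations, one for each prism lemma with a single known crossing. -/
lemma r4_transfers (a e d₀ d₁ d₂ : Bool) (h : IsY d₀ d₁ d₂) :
    (r4Left a e d₀ d₁ d₂).Transfers F [0, 1, 2, 3, 4] (r4Right a e d₀ d₁ d₂) := by
  refine transfers_of_update₃ 6 7 8 (by decide) (by decide) (by decide) fun k hk => ?_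
  cases a <;> cases e <;> cases d₀ <;> cases d₁ <;> cases d₂ <;> simp [IsY] at h <;>
    simp [Fragment.IsColored, r4Left, r4Right, cross, vertex, directed,
      Function.update_apply, -Prod.exists, -exists_and_left, -exists_and_right] at hk ⊢ <;>
    obtain ⟨h₁, h₂⟩ := hk <;>
    first
    | obtain ⟨_, _, _, l, l', l''⟩ := prism_over_p h₁ h₂
      first | exact ⟨_, _, _, l, l', l''⟩ | exact ⟨_, _, _, l, l'', l'⟩
    | obtain ⟨_, _, _, l, l', l''⟩ := prism_over_q h₁ h₂
      first | exact ⟨_, _, _, l, l', l''⟩ | exact ⟨_, _, _, l, l'', l'⟩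
    | obtain ⟨_, _, _, l, l', l''⟩ := prism_over_r h₁ h₂
      first | exact ⟨_, _, _, l, l', l''⟩ | exact ⟨_, _, _, l, l'', l'⟩
    | obtain ⟨_, _, _, l, l', l''⟩ := prism_over_primed_p h₁ h₂
      first | exact ⟨_, _, _, l, l', l''⟩ | exact ⟨_, _, _, l, l'', l'⟩
    | obtain ⟨_, _, _, l, l', l''⟩ := prism_over_primed_q h₁ h₂
      first | exact ⟨_, _, _, l, l', l''⟩ | exact ⟨_, _, _, l, l'', l'⟩
    | obtain ⟨_, _, _, l, l', l''⟩ := prism_over_primed_r h₁ h₂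
      first | exact ⟨_, _, _, l, l', l''⟩ | exact ⟨_, _, _, l, l'', l'⟩
    | obtain ⟨_, _, _, l, l', l''⟩ := prism_under_p h₁ h₂
      first | exact ⟨_, _, _, l, l', l''⟩ | exact ⟨_, _, _, l, l'', l'⟩
    | obtain ⟨_, _, _, l, l', l''⟩ := prism_under_q h₁ h₂
      first | exact ⟨_, _, _, l, l', l''⟩ | exact ⟨_, _, _, l, l'', l'⟩
    | obtain ⟨_, _, _, l, l', l''⟩ := prism_under_r h₁ h₂
      first | exact ⟨_, _, _, l, l', l''⟩ | exact ⟨_, _, _, l, l'', l'⟩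
    | obtain ⟨_, _, _, l, l', l''⟩ := prism_under_primed_p h₁ h₂
      first | exact ⟨_, _, _, l, l', l''⟩ | exact ⟨_, _, _, l, l'', l'⟩
    | obtain ⟨_, _, _, l, l', l''⟩ := prism_under_primed_q h₁ h₂
      first | exact ⟨_, _, _, l, l', l''⟩ | exact ⟨_, _, _, l, l'', l'⟩
    | obtain ⟨_, _, _, l, l', l''⟩ := prism_under_primed_r h₁ h₂
      first | exact ⟨_, _, _, l, l', l''⟩ | exact ⟨_, _, _, l, l'', l'⟩

lemma r4_transfers_symm (a e d₀ d₁ d₂ : Bool) (h : IsY d₀ d₁ d₂) :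
    (r4Right a e d₀ d₁ d₂).Transfers F [0, 1, 2, 3, 4] (r4Left a e d₀ d₁ d₂) := by
  refine transfers_of_update₁ 5 (by decide) fun k hk => ?_
  cases a <;> cases e <;> cases d₀ <;> cases d₁ <;> cases d₂ <;> simp [IsY] at h <;>
    simp [Fragment.IsColored, r4Left, r4Right, cross, vertex, directed,
      Function.update_apply, -Prod.exists, -exists_and_left, -exists_and_right] at hk ⊢ <;>
    obtain ⟨h₁, h₂, h₃⟩ := hk <;>
    first
    | exact prism_over_qr h₁ h₂ h₃
    | exact prism_over_qr h₁ h₃ h₂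
    | exact prism_over_pr h₁ h₂ h₃
    | exact prism_over_pr h₁ h₃ h₂
    | exact prism_over_pq h₁ h₂ h₃
    | exact prism_over_pq h₁ h₃ h₂
    | exact prism_over_primed_qr h₁ h₂ h₃
    | exact prism_over_primed_qr h₁ h₃ h₂
    | exact prism_over_primed_pr h₁ h₂ h₃
    | exact prism_over_primed_pr h₁ h₃ h₂
    | exact prism_over_primed_pq h₁ h₂ h₃
    | exact prism_over_primed_pq h₁ h₃ h₂
    | exact prism_under_qr h₁ h₂ h₃
    | exact prism_under_qr h₁ h₃ h₂
    | exact prism_under_pr h₁ h₂ h₃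
    | exact prism_under_pr h₁ h₃ h₂
    | exact prism_under_pq h₁ h₂ h₃
    | exact prism_under_pq h₁ h₃ h₂
    | exact prism_under_primed_qr h₁ h₂ h₃
    | exact prism_under_primed_qr h₁ h₃ h₂
    | exact prism_under_primed_pr h₁ h₂ h₃
    | exact prism_under_primed_pr h₁ h₃ h₂
    | exact prism_under_primed_pq h₁ h₂ h₃
    | exact prism_under_primed_pq h₁ h₃ h₂

/-- The outer pieces `1` and `2` form a corner of the new crossing and so give the inner colours; a
twist identity then carries the product over to the new vertex. -/
lemma r5_transfers [Finite X] (a d₀ d₁ d₂ : Bool) (h : IsY d₀ d₁ d₂) :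
    (r5Left d₀ d₁ d₂).Transfers F [0, 1, 2] (r5Right a d₀ d₁ d₂) := by
  suffices h : ∀ k : ℕ → X × G, (r5Left d₀ d₁ d₂).IsColored F k → ∃ x y,
      (r5Right a d₀ d₁ d₂).IsColored F (Function.update (Function.update k 3 x) 4 y) by
    refine fun k hk => ?_
    obtain ⟨x, y, hx⟩ := h k hk
    exact ⟨_, hx, by simp [Function.update_apply]⟩
  intro k hk
  cases a <;> cases d₀ <;> cases d₁ <;> cases d₂ <;> simp [IsY] at h <;>
    simp [Fragment.IsColored, r5Left, r5Right, cross, vertex, directed,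
      Function.update_apply, -Prod.exists, -exists_and_left, -exists_and_right] at hk ⊢ <;>
    first
    | obtain ⟨_, _, c⟩ := Crossed.mk_AD (F := F) (k 1) (k 2)
      exact ⟨_, _, by grind only [mul_iff_of_crossed, mul_iff_of_crossed_product_left,
        mul_iff_of_crossed_product_right], c⟩
    | obtain ⟨_, _, c⟩ := Crossed.mk_AD (F := F) (k 2) (k 1)
      exact ⟨_, _, by grind only [mul_iff_of_crossed, mul_iff_of_crossed_product_left,
        mul_iff_of_crossed_product_right], c⟩
    | obtain ⟨_, _, c⟩ := Crossed.mk_BC (F := F) (k 1) (k 2)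
      exact ⟨_, _, by grind only [mul_iff_of_crossed, mul_iff_of_crossed_product_left,
        mul_iff_of_crossed_product_right], c⟩
    | obtain ⟨_, _, c⟩ := Crossed.mk_BC (F := F) (k 2) (k 1)
      exact ⟨_, _, by grind only [mul_iff_of_crossed, mul_iff_of_crossed_product_left,
        mul_iff_of_crossed_product_right], c⟩
    | obtain ⟨_, _, c⟩ := Crossed.mk_AC (F := F) (k 1) (k 2)
      exact ⟨_, _, by grind only [mul_iff_of_crossed, mul_iff_of_crossed_product_left,
        mul_iff_of_crossed_product_right], c⟩
    | obtain ⟨_, _, c⟩ := Crossed.mk_AC (F := F) (k 2) (k 1)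
      exact ⟨_, _, by grind only [mul_iff_of_crossed, mul_iff_of_crossed_product_left,
        mul_iff_of_crossed_product_right], c⟩
    | obtain ⟨_, _, c⟩ := Crossed.mk_BD (F := F) (k 1) (k 2)
      exact ⟨_, _, by grind only [mul_iff_of_crossed, mul_iff_of_crossed_product_left,
        mul_iff_of_crossed_product_right], c⟩
    | obtain ⟨_, _, c⟩ := Crossed.mk_BD (F := F) (k 2) (k 1)
      exact ⟨_, _, by grind only [mul_iff_of_crossed, mul_iff_of_crossed_product_left,
        mul_iff_of_crossed_product_right], c⟩

lemma r5_transfers_symm [Finite X] (a d₀ d₁ d₂ : Bool) (h : IsY d₀ d₁ d₂) :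
    (r5Right a d₀ d₁ d₂).Transfers F [0, 1, 2] (r5Left d₀ d₁ d₂) := by
  refine fun k hk => ⟨k, ?_, fun _ _ => rfl⟩
  cases a <;> cases d₀ <;> cases d₁ <;> cases d₂ <;> simp [IsY] at h <;>
    simp [Fragment.IsColored, r5Left, r5Right, cross, vertex, directed] at hk ⊢ <;>
    first
    | exact (mul_iff_of_crossed hk.2).1 hk.1
    | exact (mul_iff_of_crossed hk.2).2 hk.1
    | exact (mul_iff_of_crossed_product_left hk.2).1 hk.1
    | exact (mul_iff_of_crossed_product_left hk.2).2 hk.1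
    | exact (mul_iff_of_crossed_product_right hk.2).1 hk.1
    | exact (mul_iff_of_crossed_product_right hk.2).2 hk.1

/-- The move replaces an edge of the tetrahedron of products by the opposite one; the orientations
decide which. -/
lemma r6_transfers [Finite X] (m m' d₀ d₁ d₂ d₃ : Bool) (hn : IsY d₀ d₁ m)
    (hs : IsY d₂ d₃ (!m)) (hw : IsY m' d₁ d₂) (he : IsY d₀ (!m') d₃) :
    (r6Left m d₀ d₁ d₂ d₃).Transfers F [0, 1, 2, 3] (r6Right m' d₀ d₁ d₂ d₃) := by
  refine transfers_of_update₁ 4 (by decide) fun k hk => ?_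
  cases m <;> cases m' <;> cases d₀ <;> cases d₁ <;> cases d₂ <;> cases d₃ <;>
    simp [IsY] at hn hs hw he <;>
    simp [Fragment.IsColored, r6Left, r6Right, vertex, Function.update_apply, -Prod.exists,
      -exists_and_left, -exists_and_right] at hk ⊢ <;>
    obtain ⟨h, h'⟩ := hk <;>
    first
    | obtain ⟨_, l, l'⟩ := assoc_left h h'
      first | exact ⟨_, l, l'⟩ | exact ⟨_, l', l⟩
    | obtain ⟨_, l, l'⟩ := assoc_left h' h
      first | exact ⟨_, l, l'⟩ | exact ⟨_, l', l⟩
    | obtain ⟨_, l, l'⟩ := assoc_right h h'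
      first | exact ⟨_, l, l'⟩ | exact ⟨_, l', l⟩
    | obtain ⟨_, l, l'⟩ := assoc_right h' h
      first | exact ⟨_, l, l'⟩ | exact ⟨_, l', l⟩
    | obtain ⟨_, l, l'⟩ := assoc_of_inner_first h h'
      first | exact ⟨_, l, l'⟩ | exact ⟨_, l', l⟩
    | obtain ⟨_, l, l'⟩ := assoc_of_inner_first h' h
      first | exact ⟨_, l, l'⟩ | exact ⟨_, l', l⟩
    | obtain ⟨_, l, l'⟩ := assoc_of_inner_last h h'
      first | exact ⟨_, l, l'⟩ | exact ⟨_, l', l⟩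
    | obtain ⟨_, l, l'⟩ := assoc_of_inner_last h' h
      first | exact ⟨_, l, l'⟩ | exact ⟨_, l', l⟩
    | obtain ⟨_, l, l'⟩ := assoc_of_inner_middle h h'
      first | exact ⟨_, l, l'⟩ | exact ⟨_, l', l⟩
    | obtain ⟨_, l, l'⟩ := assoc_of_inner_middle h' h
      first | exact ⟨_, l, l'⟩ | exact ⟨_, l', l⟩
    | obtain ⟨_, l, l'⟩ := assoc_of_inner_total h h'
      first | exact ⟨_, l, l'⟩ | exact ⟨_, l', l⟩
    | obtain ⟨_, l, l'⟩ := assoc_of_inner_total h' h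
      first | exact ⟨_, l, l'⟩ | exact ⟨_, l', l⟩

lemma r6_transfers_symm [Finite X] (m m' d₀ d₁ d₂ d₃ : Bool) (hn : IsY d₀ d₁ m)
    (hs : IsY d₂ d₃ (!m)) (hw : IsY m' d₁ d₂) (he : IsY d₀ (!m') d₃) :
    (r6Right m' d₀ d₁ d₂ d₃).Transfers F [0, 1, 2, 3] (r6Left m d₀ d₁ d₂ d₃) := by
  refine transfers_of_update₁ 4 (by decide) fun k hk => ?_
  cases m <;> cases m' <;> cases d₀ <;> cases d₁ <;> cases d₂ <;> cases d₃ <;>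
    simp [IsY] at hn hs hw he <;>
    simp [Fragment.IsColored, r6Left, r6Right, vertex, Function.update_apply, -Prod.exists,
      -exists_and_left, -exists_and_right] at hk ⊢ <;>
    obtain ⟨h, h'⟩ := hk <;>
    first
    | obtain ⟨_, l, l'⟩ := assoc_left h h'
      first | exact ⟨_, l, l'⟩ | exact ⟨_, l', l⟩
    | obtain ⟨_, l, l'⟩ := assoc_left h' h
      first | exact ⟨_, l, l'⟩ | exact ⟨_, l', l⟩
    | obtain ⟨_, l, l'⟩ := assoc_right h h'
      first | exact ⟨_, l, l'⟩ | exact ⟨_, l', l⟩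
    | obtain ⟨_, l, l'⟩ := assoc_right h' h
      first | exact ⟨_, l, l'⟩ | exact ⟨_, l', l⟩
    | obtain ⟨_, l, l'⟩ := assoc_of_inner_first h h'
      first | exact ⟨_, l, l'⟩ | exact ⟨_, l', l⟩
    | obtain ⟨_, l, l'⟩ := assoc_of_inner_first h' h
      first | exact ⟨_, l, l'⟩ | exact ⟨_, l', l⟩
    | obtain ⟨_, l, l'⟩ := assoc_of_inner_last h h'
      first | exact ⟨_, l, l'⟩ | exact ⟨_, l', l⟩
    | obtain ⟨_, l, l'⟩ := assoc_of_inner_last h' h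
      first | exact ⟨_, l, l'⟩ | exact ⟨_, l', l⟩
    | obtain ⟨_, l, l'⟩ := assoc_of_inner_middle h h'
      first | exact ⟨_, l, l'⟩ | exact ⟨_, l', l⟩
    | obtain ⟨_, l, l'⟩ := assoc_of_inner_middle h' h
      first | exact ⟨_, l, l'⟩ | exact ⟨_, l', l⟩
    | obtain ⟨_, l, l'⟩ := assoc_of_inner_total h h'
      first | exact ⟨_, l, l'⟩ | exact ⟨_, l', l⟩
    | obtain ⟨_, l, l'⟩ := assoc_of_inner_total h' h
      first | exact ⟨_, l, l'⟩ | exact ⟨_, l', l⟩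

universe u

/-- The boundary `B` is chosen before the family, so that one and the same `B` serves `X` and the
one-point set. -/
lemma Local.coloring_correspondence {P P' : Fragment} (h : Local P P') :
    ∃ B : List ℕ, P.HasBoundary B ∧ P'.HasBoundary B ∧
      ∀ (X : Type u) [Finite X] (F : BiquandleFamily G X), P.IsDetermined F B ∧
        P'.IsDetermined F B ∧ P.Transfers F B P' ∧ P'.Transfers F B P := by
  cases h with
  | r1 s u => exact ⟨_, (r1_boundary s u).1, (r1_boundary s u).2, fun X _ F =>
      ⟨isDetermined_r1Left, isDetermined_r1Right s u, r1_transfers s u, r1_transfers_symm s u⟩⟩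
  | r2 s u => exact ⟨_, (r2_boundary s u).1, (r2_boundary s u).2, fun X _ F =>
      ⟨isDetermined_r2Left, isDetermined_r2Right s u, r2_transfers s u, r2_transfers_symm s u⟩⟩
  | r3 x y z => exact ⟨_, r3_boundary x y z true, r3_boundary x y z false, fun X _ F =>
      ⟨isDetermined_r3 x y z true, isDetermined_r3 x y z false, r3_transfers x y z,
        r3_transfers_symm x y z⟩⟩
  | r4 a e d₀ d₁ d₂ h => exact ⟨_, (r4_boundary a e d₀ d₁ d₂ h).1, (r4_boundary a e d₀ d₁ d₂ h).2,
      fun X _ F => ⟨isDetermined_r4Left a e d₀ d₁ d₂ h, isDetermined_r4Right a e d₀ d₁ d₂ h,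
        r4_transfers a e d₀ d₁ d₂ h, r4_transfers_symm a e d₀ d₁ d₂ h⟩⟩
  | r5 a d₀ d₁ d₂ h => exact ⟨_, (r5_boundary a d₀ d₁ d₂ h).1, (r5_boundary a d₀ d₁ d₂ h).2,
      fun X _ F => ⟨isDetermined_r5Left d₀ d₁ d₂, isDetermined_r5Right a d₀ d₁ d₂ h,
        r5_transfers a d₀ d₁ d₂ h, r5_transfers_symm a d₀ d₁ d₂ h⟩⟩
  | r6 m m' d₀ d₁ d₂ d₃ hn hs hw he => exact ⟨_, r6Left_boundary m d₀ d₁ d₂ d₃ hn hs,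
      r6Right_boundary m' d₀ d₁ d₂ d₃ hw he, fun X _ F =>
        ⟨isDetermined_r6Left m d₀ d₁ d₂ d₃ hn hs, isDetermined_r6Right m' d₀ d₁ d₂ d₃ hw he,
          r6_transfers m m' d₀ d₁ d₂ d₃ hn hs hw he, r6_transfers_symm m m' d₀ d₁ d₂ d₃ hn hs hw he⟩⟩

end Move

/-! ### Gluing a picture to the outside, and passing from pieces to semiarcs. -/

section Coloring

variable {G : Type*} [Group G] {X : Type*} {F : BiquandleFamily G X}

namespace Node

variable {E E' : Type*}

lemma isColored_map (f : E → E') (c : E' → X × G) (n : Node E) :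
    (n.map f).IsColored F c ↔ n.IsColored F (c ∘ f) := by
  rcases n with ⟨_ | _, _, _, _, _⟩ | _ | _ <;> rfl

lemma isColored_congr {c c' : E → X × G} {n : Node E} (h : ∀ d ∈ n.ends, c d.1 = c' d.1) :
    n.IsColored F c ↔ n.IsColored F c' := by
  rcases n with ⟨_ | _, _, _, _, _⟩ | _ | _ <;> simp [ends] at h <;> simp [h]

lemma ends_map (f : E → E') (n : Node E) : (n.map f).ends = n.ends.map (Prod.map f id) := by
  rcases n with ⟨_ | _, _, _, _, _⟩ | _ | _ <;> rfl

end Node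

namespace Fragment

variable {P P' O : Fragment} {f : ℕ → ℕ} {B : List ℕ}

lemma isColored_map {k : ℕ → X × G} : (P.map f).IsColored F k ↔ P.IsColored F (k ∘ f) := by
  simp only [IsColored, map, List.forall_mem_map, Node.isColored_map]
  rfl

lemma isColored_append {k : ℕ → X × G} :
    (P.append O).IsColored F k ↔ P.IsColored F k ∧ O.IsColored F k := by
  simp only [IsColored, append, List.mem_append, or_imp, forall_and]
  tauto

lemma mem_ends {d : ℕ × Bool} : d ∈ P.ends ↔
    (∃ s ∈ P.strands, d = (s.1, false) ∨ d = (s.2, true)) ∨ ∃ n ∈ P.nodes, d ∈ n.ends := by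
  simp [ends]

lemma isColored_of_eq {k k' : ℕ → X × G} (h : ∀ d ∈ P.ends, k d.1 = k' d.1)
    (hk : P.IsColored F k) : P.IsColored F k' := by
  refine ⟨fun s hs => ?_, fun n hn => ?_⟩
  · rw [← h (s.1, false) (mem_ends.2 (.inl ⟨s, hs, .inl rfl⟩)),
      ← h (s.2, true) (mem_ends.2 (.inl ⟨s, hs, .inr rfl⟩))]
    exact hk.1 s hs
  · exact (Node.isColored_congr fun d hd => h d (mem_ends.2 (.inr ⟨n, hn, hd⟩))).1 (hk.2 n hn)

lemma ends_map : (P.map f).ends = P.ends.map (Prod.map f id) := by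
  simp [ends, map, List.flatMap_map, List.map_flatMap, Node.ends_map]

lemma ends_append_perm : (P.append O).ends.Perm (P.ends ++ O.ends) := by
  simp only [ends, append, List.flatMap_append]
  grind [List.perm_append_comm, List.perm_append_comm_assoc]

lemma mem_ends_append {d : ℕ × Bool} : d ∈ (P.append O).ends ↔ d ∈ P.ends ∨ d ∈ O.ends := by
  rw [ends_append_perm.mem_iff, List.mem_append]

lemma mem_ends_map {d : ℕ × Bool} : d ∈ (P.map f).ends ↔ ∃ e ∈ P.ends, (f e.1, e.2) = d := by
  rw [ends_map, List.mem_map]; rfl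

lemma nodup_map_append (h : ((P.map f).append O).IsClosed) :
    (P.ends.map (Prod.map f id)).Nodup ∧ (P.ends.map (Prod.map f id)).Disjoint O.ends := by
  have := ends_append_perm.nodup_iff.1 h.1
  rw [ends_map, List.nodup_append'] at this
  exact ⟨this.1, this.2.2⟩

/-- The relabelling `f` may join boundary pieces. An interior piece already has both its ends in
`P`, so another piece with the same image would repeat an end, contrary to closedness. -/
lemma interior_injective (h : ((P.map f).append O).IsClosed) (hB : P.HasBoundary B)
    {d e : ℕ × Bool} (hd : d ∈ P.ends) (hd' : d.1 ∉ B) (he : e ∈ P.ends) (hf : f d.1 = f e.1) :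
    d.1 = e.1 := by
  have hde : (d.1, e.2) ∈ P.ends := by
    have := (hB.2 d hd).resolve_left hd'
    cases e.2
    exacts [this.2, this.1]
  have := List.inj_on_of_nodup_map (nodup_map_append h).1 hde he
    (Prod.ext hf rfl)
  exact congrArg (·.1) this

lemma interior_notMem (h : ((P.map f).append O).IsClosed) (hB : P.HasBoundary B)
    {d e : ℕ × Bool} (hd : d ∈ P.ends) (hd' : d.1 ∉ B) (he : e ∈ O.ends) : f d.1 ≠ e.1 := by
  intro hf
  have hde : (d.1, e.2) ∈ P.ends := by
    have := (hB.2 d hd).resolve_left hd'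
    cases e.2
    exacts [this.2, this.1]
  refine (nodup_map_append h).2 (List.mem_map_of_mem hde) ?_
  simpa [hf] using he

/-- The pieces of `P.map f` and `O` that are not in the interior of `P`. -/
def outerLabels (f : ℕ → ℕ) (O : Fragment) (B : List ℕ) : Set ℕ := O.labels ∪ f '' {a | a ∈ B}

lemma HasBoundary.mem_labels (hB : P.HasBoundary B) {a : ℕ} (ha : a ∈ B) :
    ∃ d ∈ P.ends, d.1 = a :=
  (hB.1 a ha).elim (fun h => ⟨_, h, rfl⟩) fun h => ⟨_, h, rfl⟩

lemma outerLabels_subset (hB : P.HasBoundary B) :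
    outerLabels f O B ⊆ ((P.map f).append O).labels := by
  rintro _ (⟨b, hb⟩ | ⟨a, ha, rfl⟩)
  · exact ⟨b, mem_ends_append.2 (.inr hb)⟩
  · obtain ⟨d, hd, rfl⟩ := hB.mem_labels ha
    exact ⟨d.2, mem_ends_append.2 (.inl (mem_ends_map.2 ⟨d, hd, rfl⟩))⟩

lemma IsDetermined.map_append (h : P.IsDetermined F B) (k k' : ℕ → X × G)
    (hk : ((P.map f).append O).IsColored F k) (hk' : ((P.map f).append O).IsColored F k')
    (e : ∀ a ∈ outerLabels f O B, k a = k' a) :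
    ∀ a ∈ ((P.map f).append O).labels, k a = k' a := by
  rw [isColored_append, isColored_map] at hk hk'
  rintro a ⟨b, ha⟩
  rcases mem_ends_append.1 ha with ha | ha
  · obtain ⟨d, hd, hda⟩ := mem_ends_map.1 ha
    obtain rfl : f d.1 = a := congrArg Prod.fst hda
    exact h _ _ hk.1 hk'.1 (fun a ha => e _ (.inr ⟨a, ha, rfl⟩)) d hd
  · exact e _ (.inl ⟨b, ha⟩)

open Classical in
lemma Transfers.map_append (h : P.Transfers F B P') (hB : P'.HasBoundary B)
    (hc : ((P'.map f).append O).IsClosed) (k : ℕ → X × G)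
    (hk : ((P.map f).append O).IsColored F k) :
    ∃ k', ((P'.map f).append O).IsColored F k' ∧ ∀ a ∈ outerLabels f O B, k' a = k a := by
  rw [isColored_append, isColored_map] at hk
  obtain ⟨k₁, hk₁, e⟩ := h _ hk.1
  let I (n : ℕ) (d : ℕ × Bool) : Prop := d ∈ P'.ends ∧ d.1 ∉ B ∧ f d.1 = n
  -- The new colours are used on images of interior pieces of `P'` and the old ones everywhere else;
  -- interior images meet neither each other nor the outside, so the choice is harmless.
  let k' (n : ℕ) : X × G := if h : ∃ d, I n d then k₁ h.choose.1 else k n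
  have hin : ∀ d ∈ P'.ends, k' (f d.1) = k₁ d.1 := by
    intro d hd
    by_cases hI : ∃ d', I (f d.1) d'
    · have := hI.choose_spec
      simp only [k', dif_pos hI]
      rw [interior_injective hc hB this.1 this.2.1 hd this.2.2]
    · simp only [k', dif_neg hI]
      have : d.1 ∈ B := by
        by_contra hdB
        exact hI ⟨d, hd, hdB, rfl⟩
      exact (e _ this).symm
  have hout : ∀ d ∈ O.ends, k' d.1 = k d.1 := by
    intro d hd
    refine dif_neg ?_
    rintro ⟨d', h₁, h₂, h₃⟩
    exact interior_notMem hc hB h₁ h₂ hd h₃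
  refine ⟨k', ?_, ?_⟩
  · rw [isColored_append, isColored_map]
    exact ⟨isColored_of_eq (fun d hd => (hin d hd).symm) hk₁,
      isColored_of_eq (fun d hd => (hout d hd).symm) hk.2⟩
  · rintro _ (⟨b, hb⟩ | ⟨a, ha, rfl⟩)
    · exact hout _ hb
    · obtain ⟨d, hd, rfl⟩ := hB.mem_labels ha
      exact (hin d hd).trans (e _ ha)

/-- The map `s` realizes the diagram `D` as the closed fragment `P`. -/
def Realizes (P : Fragment) (D : Diagram) (s : ℕ → D.E) : Prop :=
  (∀ e, ∃ a ∈ P.labels, s a = e) ∧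
    (∀ a ∈ P.labels, ∀ b ∈ P.labels,
      s a = s b ↔ Relation.EqvGen (fun x y => (x, y) ∈ P.strands) a b) ∧
    (P.nodes.map (Node.map s)).Perm D.nodes

variable {D D' : Diagram} {s : ℕ → D.E} {s' : ℕ → D'.E}

lemma Realizes.isColoring_iff (hs : P.Realizes D s) {c : D.E → X × G} :
    D.IsColoring F c ↔ P.IsColored F (c ∘ s) := by
  have h₁ : ∀ t ∈ P.strands, (c ∘ s) t.1 = (c ∘ s) t.2 := fun t ht =>
    congrArg c ((hs.2.1 _ ⟨false, mem_ends.2 (.inl ⟨t, ht, .inl rfl⟩)⟩ _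
      ⟨true, mem_ends.2 (.inl ⟨t, ht, .inr rfl⟩)⟩).2 (.rel _ _ ht))
  have h₂ : D.IsColoring F c ↔ ∀ n ∈ P.nodes.map (Node.map s), n.IsColored F c :=
    forall_congr' fun n => by rw [hs.2.2.mem_iff]
  rw [h₂]
  simp only [IsColored, List.forall_mem_map, Node.isColored_map]
  exact (and_iff_right h₁).symm

/-- Strands do not change colours, so pieces of one semiarc have equal colours and the colouring
descends. -/
lemma Realizes.exists_coloring (hs : P.Realizes D s) {k : ℕ → X × G} (hk : P.IsColored F k) :
    ∃ c, D.IsColoring F c ∧ ∀ a ∈ P.labels, c (s a) = k a := by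
  choose t ht hst using hs.1
  have e : ∀ a ∈ P.labels, k (t (s a)) = k a := by
    intro a ha
    have := (hs.2.1 _ (ht (s a)) _ ha).1 (hst _)
    generalize t (s a) = b at this
    clear ha
    induction this with
    | rel x y h => exact hk.1 _ h
    | refl => rfl
    | symm _ _ _ h => exact h.symm
    | trans _ _ _ _ _ h h' => exact h.trans h'
  exact ⟨k ∘ t, hs.isColoring_iff.2 (isColored_of_eq (fun d hd => (e _ ⟨d.2, hd⟩).symm) hk), e⟩

lemma Realizes.existsUnique_coloring (hs : P.Realizes D s) (hs' : P'.Realizes D' s') {B : Set ℕ}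
    (hB : B ⊆ P'.labels)
    (ht : ∀ k, P.IsColored F k → ∃ k', P'.IsColored F k' ∧ ∀ a ∈ B, k' a = k a)
    (hd : ∀ k k', P'.IsColored F k → P'.IsColored F k' → (∀ a ∈ B, k a = k' a) →
      ∀ a ∈ P'.labels, k a = k' a) {c : D.E → X × G} (hc : D.IsColoring F c) :
    ∃! c', D'.IsColoring F c' ∧ ∀ a ∈ B, c' (s' a) = c (s a) := by
  obtain ⟨k', hk', e⟩ := ht _ (hs.isColoring_iff.1 hc)
  obtain ⟨c', hc', e'⟩ := hs'.exists_coloring hk'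
  refine ⟨c', ⟨hc', fun a ha => (e' a (hB ha)).trans (e a ha)⟩, ?_⟩
  rintro c'' ⟨hc'', e''⟩
  funext x
  obtain ⟨a, ha, rfl⟩ := hs'.1 x
  exact hd _ _ (hs'.isColoring_iff.1 hc'') (hs'.isColoring_iff.1 hc')
    (fun a ha => (e'' a ha).trans ((e' a (hB ha)).trans (e a ha)).symm) a ha

end Fragment

end Coloring

-- Bijections between the colourings of related diagrams.

universe u

/-- Restriction to corresponding semiarcs induces a bijection between the colourings of `D` and of
`D'`, for all finite `G`-families. -/
def Diagram.SameColorings (G : Type*) [Group G] (D D' : Diagram) : Prop :=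
  ∃ (B : Set ℕ) (s : ℕ → D.E) (s' : ℕ → D'.E), ∀ (X : Type u) [Finite X]
    (F : BiquandleFamily G X),
    (∀ c, D.IsColoring F c → ∃! c', D'.IsColoring F c' ∧ ∀ a ∈ B, c' (s' a) = c (s a)) ∧
    (∀ c', D'.IsColoring F c' → ∃! c, D.IsColoring F c ∧ ∀ a ∈ B, c (s a) = c' (s' a))

namespace Diagram

variable {G : Type*} [Group G] {D D' : Diagram}

lemma Isotopic.sameColorings (h : Isotopic D D') : SameColorings.{u} G D D' := by
  obtain ⟨P, ⟨-, s, hs⟩, -, s', hs'⟩ := h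
  have hs : P.Realizes D s := hs
  have hs' : P.Realizes D' s' := hs'
  exact ⟨P.labels, s, s', fun X _ F =>
    ⟨fun _ hc => hs.existsUnique_coloring hs' subset_rfl (fun k hk => ⟨k, hk, fun _ _ => rfl⟩)
      (fun _ _ _ _ h => h) hc,
    fun _ hc => hs'.existsUnique_coloring hs subset_rfl (fun k hk => ⟨k, hk, fun _ _ => rfl⟩)
      (fun _ _ _ _ h => h) hc⟩⟩

lemma ReidemeisterMove.sameColorings (h : ReidemeisterMove D D') : SameColorings.{u} G D D' := by
  obtain ⟨P, P', O, f, hL, ⟨hcl, s, hs⟩, hcl', s', hs'⟩ := h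
  have hs : Fragment.Realizes _ D s := hs
  have hs' : Fragment.Realizes _ D' s' := hs'
  obtain ⟨B, hB, hB', h⟩ := hL.coloring_correspondence (G := G)
  refine ⟨Fragment.outerLabels f O B, s, s', fun X _ F => ?_⟩
  obtain ⟨hd, hd', ht, ht'⟩ := h X F
  exact ⟨fun _ hc => hs.existsUnique_coloring hs' (Fragment.outerLabels_subset hB')
      (ht.map_append hB' hcl') hd'.map_append hc,
    fun _ hc => hs'.existsUnique_coloring hs (Fragment.outerLabels_subset hB)
      (ht'.map_append hB hcl) hd.map_append hc⟩

end Diagram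

/-- The unique `G`-family on a one-point set. -/
def BiquandleFamily.onePoint (G : Type*) [Group G] : BiquandleFamily G PUnit.{u + 1} where
  uop _ _ _ := ⟨⟩
  oop _ _ _ := ⟨⟩
  under_self _ _ := rfl
  under_bijective _ _ := Function.bijective_id
  over_bijective _ _ := Function.bijective_id
  sideways_bijective _ _ := Function.bijective_id
  exchange_under_under _ _ _ _ _ := rfl
  exchange_over_under _ _ _ _ _ := rfl
  exchange_over_over _ _ _ _ _ := rfl
  under_mul _ _ _ _ := rfl
  over_mul _ _ _ _ := rfl

/-! ### Homomorphisms as one-point colourings, and comparison of the fibres. -/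

namespace Diagram

open BiquandleFamily

variable {G : Type*} [Group G] {X : Type u} {F : BiquandleFamily G X} {D D' : Diagram}

/-- On a one-point set only the `G`-components matter: conjugation at crossings and multiplication
at vertices, which is what the relators express. -/
lemma _root_.Node.isColored_onePoint {E : Type*} {c : E → PUnit.{u + 1} × G} {n : Node E} :
    n.IsColored (onePoint G) c ↔ ∀ w ∈ n.relators, FreeGroup.lift (fun e => (c e).2) w = 1 := by
  rcases n with ⟨_ | _, _, _, _, _⟩ | _ | _ <;>
    simp [Node.relators, Node.IsColored, qUnder, qOver, IsQMul, onePoint, Prod.ext_iff, mul_inv_eq_one,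
      mul_assoc, and_comm]
  all_goals
    intros
    rw [← mul_inv_eq_one]
    simp only [mul_inv_rev, inv_inv, mul_assoc]

lemma _root_.Node.IsColored.onePoint {E : Type*} {c : E → X × G} {n : Node E}
    (h : n.IsColored F c) : n.IsColored (onePoint.{u} G) (fun e => (⟨⟩, (c e).2)) := by
  rcases n with ⟨_ | _, _, _, _, _⟩ | _ | _ <;>
    simp_all [Node.IsColored, qUnder, qOver, IsQMul, BiquandleFamily.onePoint]

lemma IsColoring.onePoint {c : D.E → X × G} (h : D.IsColoring F c) :
    D.IsColoring (onePoint.{u} G) (fun e => (⟨⟩, (c e).2)) := fun n hn => Node.IsColored.onePoint (h n hn)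

/-- The meridian values of a homomorphism, as a colouring. -/
def homColoring (ψ : D.FundamentalGroup →* G) (e : D.E) : PUnit.{u + 1} × G :=
  (⟨⟩, ψ (D.meridian e))

lemma isColoring_homColoring (ψ : D.FundamentalGroup →* G) :
    D.IsColoring (onePoint.{u} G) (homColoring ψ) := by
  intro n hn
  rw [Node.isColored_onePoint]
  intro w hw
  have : FreeGroup.lift (fun e => (homColoring.{u} ψ e).2) = ψ.comp (PresentedGroup.mk _) := by
    ext e
    simp [homColoring, meridian, PresentedGroup.of]
  rw [this, MonoidHom.comp_apply, (PresentedGroup.one_of_mem (by exact ⟨n, hn, hw⟩)), map_one]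

lemma exists_homColoring {c : D.E → PUnit.{u + 1} × G} (h : D.IsColoring (onePoint.{u} G) c) :
    ∃ ψ : D.FundamentalGroup →* G, homColoring ψ = c := by
  have hw : ∀ w ∈ {w : FreeGroup D.E | ∃ n ∈ D.nodes, w ∈ n.relators},
      FreeGroup.lift (fun e => (c e).2) w = 1 := by
    rintro w ⟨n, hn, hw⟩
    exact Node.isColored_onePoint.1 (h n hn) w hw
  exact ⟨PresentedGroup.toGroup hw, funext fun e => Prod.ext rfl (PresentedGroup.toGroup.of hw)⟩

lemma homColoring_injective :
    Function.Injective (homColoring.{u} : (D.FundamentalGroup →* G) → D.E → PUnit × G) :=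
  fun _ _ h => PresentedGroup.ext fun e => congrArg Prod.snd (congrFun h e)

lemma _root_.exists_equiv_of_existsUnique {α β : Type*} {R : α → β → Prop}
    (h : ∀ a, ∃! b, R a b) (h' : ∀ b, ∃! a, R a b) : ∃ e : α ≃ β, ∀ a, R a (e a) := by
  choose f hf hf' using h
  choose g hg hg' using h'
  exact ⟨⟨f, g, fun a => (hg' _ _ (hf a)).symm, fun b => (hf' _ _ (hg b)).symm⟩, hf⟩

lemma existsUnique_hom {B : Set ℕ} {s : ℕ → D.E} {s' : ℕ → D'.E}
    (h : ∀ c, D.IsColoring (onePoint.{u} G) c →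
      ∃! c', D'.IsColoring (onePoint.{u} G) c' ∧ ∀ a ∈ B, c' (s' a) = c (s a))
    (ψ : D.FundamentalGroup →* G) : ∃! ψ' : D'.FundamentalGroup →* G,
      ∀ a ∈ B, homColoring.{u} ψ' (s' a) = homColoring ψ (s a) := by
  obtain ⟨c', ⟨hc', e⟩, huniq⟩ := h _ (isColoring_homColoring ψ)
  obtain ⟨ψ', rfl⟩ := exists_homColoring hc'
  exact ⟨ψ', e, fun ψ'' e' => homColoring_injective (huniq _ ⟨isColoring_homColoring ψ'', e'⟩)⟩

lemma mem_fiber_iff {ψ : D.FundamentalGroup →* G} {c : D.E → X × G} : c ∈ D.fiber F ψ ↔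
    D.IsColoring F c ∧ (fun e => (⟨⟩, (c e).2)) = homColoring.{u} ψ := by
  simp [fiber, homColoring, funext_iff]

lemma existsUnique_mem_fiber {B : Set ℕ} {s : ℕ → D.E} {s' : ℕ → D'.E}
    (hF : ∀ c, D.IsColoring F c → ∃! c', D'.IsColoring F c' ∧ ∀ a ∈ B, c' (s' a) = c (s a))
    (h : ∀ c, D.IsColoring (onePoint.{u} G) c →
      ∃! c', D'.IsColoring (onePoint.{u} G) c' ∧ ∀ a ∈ B, c' (s' a) = c (s a))
    {ψ : D.FundamentalGroup →* G} {ψ' : D'.FundamentalGroup →* G}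
    (e : ∀ a ∈ B, homColoring.{u} ψ' (s' a) = homColoring ψ (s a)) (c : D.fiber F ψ) :
    ∃! c' : D'.fiber F ψ', ∀ a ∈ B, c'.1 (s' a) = c.1 (s a) := by
  obtain ⟨c, hc⟩ := c
  rw [mem_fiber_iff] at hc
  obtain ⟨c', ⟨hc', ec⟩, huniq⟩ := hF c hc.1
  refine ⟨⟨c', mem_fiber_iff.2 ⟨hc', ?_⟩⟩, ec, fun c'' e'' =>
    Subtype.ext (huniq _ ⟨c''.2.1, e''⟩)⟩
  -- The projection of `c'` and the colouring of `ψ'` both correspond to `ψ` on `B`, hence they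
  -- coincide.
  refine (h _ (isColoring_homColoring ψ)).unique ⟨IsColoring.onePoint hc', fun a ha => ?_⟩
    ⟨isColoring_homColoring ψ', e⟩
  rw [← hc.2]
  simp only [ec a ha]

/-- The one-point instance matches the summation indices, and the instance for `X` then matches each
fibre with the fibre over the corresponding index. -/
lemma SameColorings.enhancedPolynomial_eq [Finite G] [Finite X] (h : SameColorings.{u} G D D')
    (F : BiquandleFamily G X) : D.enhancedPolynomial F = D'.enhancedPolynomial F := by
  obtain ⟨B, s, s', h⟩ := h
  have hF := h X F
  have hG := h _ (onePoint.{u} G)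
  obtain ⟨e, he⟩ := exists_equiv_of_existsUnique (existsUnique_hom hG.1)
    (fun ψ' => by simpa only [eq_comm] using existsUnique_hom hG.2 ψ')
  let _ := Fintype.ofFinite (D.FundamentalGroup →* G)
  let _ := Fintype.ofFinite (D'.FundamentalGroup →* G)
  refine Fintype.sum_equiv e _ _ fun ψ => congrArg _ ?_
  obtain ⟨e', -⟩ := exists_equiv_of_existsUnique (existsUnique_mem_fiber hF.1 hG.1 (he ψ))
    (fun c' => by
      simpa only [eq_comm] using
        existsUnique_mem_fiber hF.2 hG.2 (fun a ha => (he ψ a ha).symm) c')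
  exact Nat.card_congr e'

lemma Related.enhancedPolynomial_eq [Finite G] [Finite X] (h : D.Related D')
    (F : BiquandleFamily G X) : D.enhancedPolynomial F = D'.enhancedPolynomial F := by
  replace h : Relation.EqvGen (fun D D' => Isotopic D D' ∨ ReidemeisterMove D D') D D' := h
  induction h with
  | rel D D' h =>
    exact h.elim (fun h => h.sameColorings.enhancedPolynomial_eq F)
      fun h => h.sameColorings.enhancedPolynomial_eq F
  | refl => rfl
  | symm _ _ _ ih => exact ih.symm
  | trans _ _ _ _ _ ih ih' => exact ih.trans ih'

end Diagram

theorem proposition6p4 {G : Type*} [Group G] [Finite G] {X : Type*} [Finite X]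
    (F : BiquandleFamily G X) :
    (∀ D D' : Diagram, D.Related D' → D.enhancedPolynomial F = D'.enhancedPolynomial F) ∧
    ∃ Φ : HandlebodyKnot → ℤ[X],
      ∀ D : Diagram, Φ D.handlebodyKnot = D.enhancedPolynomial F :=
  ⟨fun _ _ h => h.enhancedPolynomial_eq F,
    Quotient.lift (fun D => D.enhancedPolynomial F) fun _ _ h => Diagram.Related.enhancedPolynomial_eq h F,
    fun _ => rfl⟩
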